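/- Let $a_1\ge 0$ be a real number. All function spaces consist of complex-valued functions on the interval $(0,1)$. Let $$\mathcal H=\big(H^2(0,1)\cap H^1_0(0,1)\big)\times L^2(0,1)$$ be equipped with the energy inner product $$\langle U,V\rangle_{\mathcal E}=\int_0^1 u_1''\,\overline{v_1''}\,dx+\int_0^1 u_2\,\overline{v_2}\,dx,\qquad U=(u_1,u_2),\ V=(v_1,v_2),$$ and let $\mathcal A$ be the linear operator in $\mathcal H$ given by $$\mathcal A\begin{pmatrix} w\\ v\end{pmatrix}=\begin{pmatrix} v\\ -D_x^4 w+a_1D_x^2 v\end{pmatrix},\qquad \mathrm{Dom}(\mathcal A)=H^4_*(0,1)\times\big(H^2(0,1)\cap H^1_0(0,1)\big),$$ where $H^4_*(0,1)=\{w\in H^4(0,1)\cap H^1_0(0,1): w''(0)=w''(1)=0\}$ (hinged boundary conditions). Then $\mathcal H$ is a Hilbert space, and $\mathcal A$ (with exactly this domain) is the infinitesimal generator of a $C_0$-semigroup of contractions on $\mathcal H$. -/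

import Mathlib

open MeasureTheory Set Filter Topology
open scoped ContDiff NNReal

noncomputable section

namespace HingedBeam

/-! ### Complex-valued Sobolev functions on the unit interval -/

/-- Lebesgue measure on the open interval `(0, 1)`. -/
abbrev unitVol : Measure ℝ := volume.restrict (Ioo (0 : ℝ) 1)

/-- The complex Hilbert space `L²(0, 1)`. -/
abbrev L2 : Type := Lp ℂ 2 unitVol

/-- The test functions on `(0, 1)`: smooth, with compact support contained in `(0, 1)`. -/
structure IsTestFunction (φ : ℝ → ℝ) : Prop where
  contDiff : ContDiff ℝ ∞ φ
  hasCompactSupport : HasCompactSupport φ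
  tsupport_subset : tsupport φ ⊆ Ioo (0 : ℝ) 1

/-- `g` is the weak (distributional) derivative of order `k` of `u` on `(0, 1)`:
`∫ φ⁽ᵏ⁾ u = (-1)ᵏ ∫ φ g` for all test functions `φ`. -/
def HasWeakDeriv (k : ℕ) (u g : L2) : Prop :=
  ∀ φ : ℝ → ℝ, IsTestFunction φ →
    ∫ x in Ioo (0 : ℝ) 1, iteratedDeriv k φ x • u x =
      (-1 : ℂ) ^ k * ∫ x in Ioo (0 : ℝ) 1, φ x • g x

theorem integrable_coe (u : L2) : Integrable u unitVol :=
  (Lp.memLp u).integrable one_le_two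

theorem integrable_smul {f : ℝ → ℝ} (hf : Continuous f) (hc : HasCompactSupport f) {u : ℝ → ℂ}
    (hu : Integrable u unitVol) : Integrable (fun x => f x • u x) unitVol := by
  obtain ⟨C, hC⟩ := hf.bounded_above_of_compact_support hc
  exact hu.bdd_smul C hf.aestronglyMeasurable (Eventually.of_forall hC)

theorem IsTestFunction.continuous_iteratedDeriv {φ : ℝ → ℝ} (h : IsTestFunction φ) (k : ℕ) :
    Continuous (iteratedDeriv k φ) :=
  h.contDiff.continuous_iteratedDeriv k (by exact_mod_cast le_top)

theorem hasCompactSupport_iteratedDeriv {φ : ℝ → ℝ} (h : HasCompactSupport φ) (k : ℕ) :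
    HasCompactSupport (iteratedDeriv k φ) := by
  induction k with
  | zero => simpa using h
  | succ k ih => rw [iteratedDeriv_succ]; exact ih.deriv

theorem IsTestFunction.deriv {φ : ℝ → ℝ} (h : IsTestFunction φ) : IsTestFunction (deriv φ) where
  contDiff := (contDiff_infty_iff_deriv.1 h.contDiff).2
  hasCompactSupport := h.hasCompactSupport.deriv
  tsupport_subset := (tsupport_deriv_subset (f := φ) (𝕜 := ℝ)).trans h.tsupport_subset

theorem ae_zero_of_forall_test {u : ℝ → ℂ} (hu : Integrable u unitVol)
    (h : ∀ φ : ℝ → ℝ, IsTestFunction φ → ∫ x in Ioo (0 : ℝ) 1, φ x • u x = 0) :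
    u =ᵐ[unitVol] 0 := by
  have key := isOpen_Ioo.ae_eq_zero_of_integral_contDiff_smul_eq_zero (μ := volume)
    (U := Ioo (0 : ℝ) 1) (f := u) (IntegrableOn.locallyIntegrableOn hu) ?_
  · exact (ae_restrict_iff' measurableSet_Ioo).2 key
  · intro g hg hc hs
    rw [← h g ⟨hg, hc, hs⟩]
    refine (setIntegral_eq_integral_of_forall_compl_eq_zero fun x hx => ?_).symm
    rw [image_eq_zero_of_notMem_tsupport fun hx' => hx (hs hx'), zero_smul]

theorem HasWeakDeriv.unique {k : ℕ} {u g g' : L2} (h : HasWeakDeriv k u g)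
    (h' : HasWeakDeriv k u g') : g = g' := by
  rw [← sub_eq_zero, Lp.eq_zero_iff_ae_eq_zero]
  refine ae_zero_of_forall_test (integrable_coe _) fun φ hφ => ?_
  have e : ∫ x in Ioo (0 : ℝ) 1, φ x • (g - g' : L2) x =
      ∫ x in Ioo (0 : ℝ) 1, (φ x • g x - φ x • g' x) := by
    refine integral_congr_ae ?_
    filter_upwards [Lp.coeFn_sub g g'] with x hx
    rw [hx, Pi.sub_apply, smul_sub]
  have hc : Continuous φ := hφ.contDiff.continuous
  rw [e, integral_sub (integrable_smul hc hφ.hasCompactSupport (integrable_coe g))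
    (integrable_smul hc hφ.hasCompactSupport (integrable_coe g')), sub_eq_zero]
  have := (h φ hφ).symm.trans (h' φ hφ)
  exact mul_left_cancel₀ (pow_ne_zero k (by norm_num)) this

theorem HasWeakDeriv.add {k : ℕ} {u g u' g' : L2} (h : HasWeakDeriv k u g)
    (h' : HasWeakDeriv k u' g') : HasWeakDeriv k (u + u') (g + g') := by
  intro φ hφ
  have aux : ∀ (f : ℝ → ℝ), Continuous f → HasCompactSupport f → ∀ v w : L2,
      ∫ x in Ioo (0 : ℝ) 1, f x • (v + w : L2) x =
        (∫ x in Ioo (0 : ℝ) 1, f x • v x) + ∫ x in Ioo (0 : ℝ) 1, f x • w x := by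
    intro f hf hc v w
    rw [← integral_add (integrable_smul hf hc (integrable_coe v))
      (integrable_smul hf hc (integrable_coe w))]
    refine integral_congr_ae ?_
    filter_upwards [Lp.coeFn_add v w] with x hx
    rw [hx, Pi.add_apply, smul_add]
  rw [aux _ (hφ.continuous_iteratedDeriv k)
      (hasCompactSupport_iteratedDeriv hφ.hasCompactSupport k),
    aux _ hφ.contDiff.continuous hφ.hasCompactSupport, h φ hφ, h' φ hφ, mul_add]

theorem HasWeakDeriv.smul {k : ℕ} {u g : L2} (c : ℂ) (h : HasWeakDeriv k u g) :
    HasWeakDeriv k (c • u) (c • g) := by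
  intro φ hφ
  have aux : ∀ (f : ℝ → ℝ) (v : L2), ∫ x in Ioo (0 : ℝ) 1, f x • (c • v : L2) x =
      c * ∫ x in Ioo (0 : ℝ) 1, f x • v x := by
    intro f v
    rw [← integral_const_mul]
    refine integral_congr_ae ?_
    filter_upwards [Lp.coeFn_smul c v] with x hx
    rw [hx, Pi.smul_apply, smul_eq_mul, mul_smul_comm]
  rw [aux, aux, h φ hφ]
  ring

theorem integral_smul_zero (f : ℝ → ℝ) : ∫ x in Ioo (0 : ℝ) 1, f x • (0 : L2) x = 0 := by
  refine integral_eq_zero_of_ae ?_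
  filter_upwards [Lp.coeFn_zero ℂ 2 unitVol] with x hx
  rw [hx, Pi.zero_apply, smul_zero]

theorem HasWeakDeriv.zero (k : ℕ) : HasWeakDeriv k 0 0 := by
  intro φ _
  rw [integral_smul_zero, integral_smul_zero, mul_zero]

/-- The Sobolev space `H^m(0, 1)`: the functions in `L²(0, 1)` whose weak derivatives of all orders
`k ≤ m` exist and belong to `L²(0, 1)`. -/
def Sobolev (m : ℕ) : Submodule ℂ L2 where
  carrier := {u | ∀ k ≤ m, ∃ g : L2, HasWeakDeriv k u g}
  zero_mem' k _ := ⟨0, HasWeakDeriv.zero k⟩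
  add_mem' hu hv k hk := by
    obtain ⟨g, hg⟩ := hu k hk
    obtain ⟨g', hg'⟩ := hv k hk
    exact ⟨g + g', hg.add hg'⟩
  smul_mem' c _ hu k hk := by
    obtain ⟨g, hg⟩ := hu k hk
    exact ⟨c • g, hg.smul c⟩

open Classical in
/-- The weak derivative `D_x^k u ∈ L²(0, 1)` (with the value `0` if it does not exist). -/
def weakDeriv (k : ℕ) (u : L2) : L2 :=
  if h : ∃ g : L2, HasWeakDeriv k u g then h.choose else 0

theorem hasWeakDeriv_weakDeriv {k m : ℕ} {u : L2} (hu : u ∈ Sobolev m) (hk : k ≤ m) :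
    HasWeakDeriv k u (weakDeriv k u) := by
  have h := hu k hk
  rw [weakDeriv, dif_pos h]
  exact h.choose_spec

theorem weakDeriv_add {k m : ℕ} {u v : L2} (hu : u ∈ Sobolev m) (hv : v ∈ Sobolev m)
    (hk : k ≤ m) : weakDeriv k (u + v) = weakDeriv k u + weakDeriv k v :=
  (hasWeakDeriv_weakDeriv (add_mem hu hv) hk).unique
    ((hasWeakDeriv_weakDeriv hu hk).add (hasWeakDeriv_weakDeriv hv hk))

theorem weakDeriv_smul {k m : ℕ} (c : ℂ) {u : L2} (hu : u ∈ Sobolev m) (hk : k ≤ m) :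
    weakDeriv k (c • u) = c • weakDeriv k u :=
  (hasWeakDeriv_weakDeriv (Submodule.smul_mem _ c hu) hk).unique
    ((hasWeakDeriv_weakDeriv hu hk).smul c)

theorem weakDeriv_zero (k : ℕ) : weakDeriv k 0 = 0 :=
  (hasWeakDeriv_weakDeriv (zero_mem (Sobolev k)) le_rfl).unique (HasWeakDeriv.zero k)

/-- `u` is represented by a continuous function on `[0, 1]` that vanishes at `0` and at `1`. -/
def VanishesAtEnds (u : L2) : Prop :=
  ∃ f : ℝ → ℂ, ContinuousOn f (Icc 0 1) ∧ u =ᵐ[unitVol] f ∧ f 0 = 0 ∧ f 1 = 0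

theorem VanishesAtEnds.zero : VanishesAtEnds 0 :=
  ⟨0, continuousOn_const, Lp.coeFn_zero ℂ 2 unitVol, rfl, rfl⟩

theorem VanishesAtEnds.add {u v : L2} (hu : VanishesAtEnds u) (hv : VanishesAtEnds v) :
    VanishesAtEnds (u + v) := by
  obtain ⟨f, hf, hfu, hf0, hf1⟩ := hu
  obtain ⟨g, hg, hgv, hg0, hg1⟩ := hv
  exact ⟨f + g, hf.add hg, (Lp.coeFn_add u v).trans (hfu.add hgv), by simp [hf0, hg0],
    by simp [hf1, hg1]⟩

theorem VanishesAtEnds.smul {u : L2} (c : ℂ) (hu : VanishesAtEnds u) :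
    VanishesAtEnds (c • u) := by
  obtain ⟨f, hf, hfu, hf0, hf1⟩ := hu
  exact ⟨c • f, hf.const_smul c, (Lp.coeFn_smul c u).trans (hfu.const_smul c), by simp [hf0],
    by simp [hf1]⟩

/-- `H^1_0(0, 1)`: the functions in `H^1(0, 1)` that vanish at both ends of the interval. -/
def H10 : Submodule ℂ L2 where
  carrier := {u | u ∈ Sobolev 1 ∧ VanishesAtEnds u}
  zero_mem' := ⟨zero_mem _, VanishesAtEnds.zero⟩
  add_mem' hu hv := ⟨add_mem hu.1 hv.1, hu.2.add hv.2⟩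
  smul_mem' c _ hu := ⟨Submodule.smul_mem _ c hu.1, hu.2.smul c⟩

/-- `H^2(0, 1) ∩ H^1_0(0, 1)`. -/
def H2H10 : Submodule ℂ L2 := Sobolev 2 ⊓ H10

theorem mem_sobolev_two {u : L2} (hu : u ∈ H2H10) : u ∈ Sobolev 2 := hu.1

/-- `H^4_*(0, 1) = {w ∈ H^4(0, 1) ∩ H^1_0(0, 1) : w''(0) = w''(1) = 0}`. -/
def H4star : Submodule ℂ L2 where
  carrier := {w | w ∈ Sobolev 4 ∧ w ∈ H10 ∧ VanishesAtEnds (weakDeriv 2 w)}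
  zero_mem' := ⟨zero_mem _, zero_mem _, by rw [weakDeriv_zero]; exact VanishesAtEnds.zero⟩
  add_mem' hu hv := ⟨add_mem hu.1 hv.1, add_mem hu.2.1 hv.2.1, by
    rw [weakDeriv_add hu.1 hv.1 (by norm_num)]; exact hu.2.2.add hv.2.2⟩
  smul_mem' c _ hu := ⟨Submodule.smul_mem _ c hu.1, Submodule.smul_mem _ c hu.2.1, by
    rw [weakDeriv_smul c hu.1 (by norm_num)]; exact hu.2.2.smul c⟩

/-! ### The energy form is definite -/

theorem exists_Icc_of_isCompact {K : Set ℝ} (hK : IsCompact K) (hs : K ⊆ Ioo (0 : ℝ) 1) :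
    ∃ a b : ℝ, 0 < a ∧ b < 1 ∧ a ≤ b ∧ K ⊆ Icc a b := by
  have hK' : IsCompact (insert (1 / 2 : ℝ) K) := hK.insert _
  have hs' : insert (1 / 2 : ℝ) K ⊆ Ioo (0 : ℝ) 1 := insert_subset (by norm_num) hs
  obtain ⟨a, ha⟩ := hK'.exists_isLeast (insert_nonempty _ _)
  obtain ⟨b, hb⟩ := hK'.exists_isGreatest (insert_nonempty _ _)
  exact ⟨a, b, (hs' ha.1).1, (hs' hb.1).2, ha.2 hb.1,
    fun x hx => ⟨ha.2 (mem_insert_of_mem _ hx), hb.2 (mem_insert_of_mem _ hx)⟩⟩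

theorem exists_primitive {f : ℝ → ℝ} (hf : IsTestFunction f)
    (h0 : ∫ x in Ioo (0 : ℝ) 1, f x = 0) : ∃ F : ℝ → ℝ, IsTestFunction F ∧ deriv F = f := by
  obtain ⟨a, b, ha, hb, hab, hK⟩ := exists_Icc_of_isCompact hf.hasCompactSupport hf.tsupport_subset
  have hz : ∀ x, x ∉ Icc a b → f x = 0 := fun x hx =>
    image_eq_zero_of_notMem_tsupport fun hx' => hx (hK hx')
  have hcont : Continuous f := hf.contDiff.continuous
  have hint : ∀ x y : ℝ, IntervalIntegrable f volume x y := fun x y => hcont.intervalIntegrable x y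
  have hF : ∀ x, HasDerivAt (fun x => ∫ t in (0 : ℝ)..x, f t) (f x) x := fun x =>
    intervalIntegral.integral_hasDerivAt_right (hint _ _)
      (hcont.stronglyMeasurableAtFilter _ _) hcont.continuousAt
  have hd : deriv (fun x => ∫ t in (0 : ℝ)..x, f t) = f := funext fun x => (hF x).deriv
  have hsupp : Function.support (fun x => ∫ t in (0 : ℝ)..x, f t) ⊆ Icc a b := by
    intro x hx
    by_contra hx'
    apply hx
    rcases lt_or_ge x a with hxa | hxa
    · refine intervalIntegral.integral_zero_ae (Eventually.of_forall fun t ht => hz t fun ht' => ?_)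
      have : t ≤ max 0 x := ht.2
      have : max 0 x < a := max_lt ha hxa
      linarith [ht'.1]
    · have hxb : b < x := by
        by_contra hh
        exact hx' ⟨hxa, not_lt.1 hh⟩
      have e1 : ∫ t in (0 : ℝ)..1, f t = 0 := by
        rw [intervalIntegral.integral_of_le zero_le_one, integral_Ioc_eq_integral_Ioo, h0]
      have e2 : ∫ t in (1 : ℝ)..x, f t = 0 := by
        refine intervalIntegral.integral_zero_ae
          (Eventually.of_forall fun t ht => hz t fun ht' => ?_)
        have : min 1 x < t := ht.1
        have : b < min 1 x := lt_min hb hxb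
        linarith [ht'.2]
      change ∫ t in (0 : ℝ)..x, f t = 0
      rw [← intervalIntegral.integral_add_adjacent_intervals (hint 0 1) (hint 1 x), e1, e2,
        add_zero]
  refine ⟨_, ⟨?_, HasCompactSupport.of_support_subset_isCompact isCompact_Icc hsupp, ?_⟩, hd⟩
  · rw [contDiff_infty_iff_deriv, hd]
    exact ⟨fun x => (hF x).differentiableAt, hf.contDiff⟩
  · exact (closure_minimal hsupp isClosed_Icc).trans fun x hx =>
      ⟨ha.trans_le hx.1, hx.2.trans_lt hb⟩

theorem exists_test_integral_one :
    ∃ η : ℝ → ℝ, IsTestFunction η ∧ ∫ x in Ioo (0 : ℝ) 1, η x = 1 := by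
  let B : ContDiffBump (1 / 2 : ℝ) := ⟨1 / 8, 1 / 4, by norm_num, by norm_num⟩
  have hs : tsupport (B.normed volume) ⊆ Ioo (0 : ℝ) 1 := by
    rw [B.tsupport_normed_eq]
    intro x hx
    rw [Metric.mem_closedBall, Real.dist_eq, abs_le] at hx
    change -(1 / 4) ≤ _ ∧ _ ≤ (1 / 4 : ℝ) at hx
    constructor <;> linarith [hx.1, hx.2]
  refine ⟨B.normed volume, ⟨B.contDiff_normed, B.hasCompactSupport_normed, hs⟩, ?_⟩
  rw [setIntegral_eq_integral_of_forall_compl_eq_zero fun x hx =>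
    image_eq_zero_of_notMem_tsupport fun hx' => hx (hs hx'), B.integral_normed]

theorem ae_const_of_forall_test {u : ℝ → ℂ} (hu : Integrable u unitVol)
    (h : ∀ φ : ℝ → ℝ, IsTestFunction φ → ∫ x in Ioo (0 : ℝ) 1, deriv φ x • u x = 0) :
    ∃ c : ℂ, u =ᵐ[unitVol] fun _ => c := by
  obtain ⟨η, hη, hη1⟩ := exists_test_integral_one
  refine ⟨∫ x in Ioo (0 : ℝ) 1, η x • u x, ?_⟩
  set c := ∫ x in Ioo (0 : ℝ) 1, η x • u x with hc
  have hi : ∀ {φ : ℝ → ℝ}, IsTestFunction φ → ∀ {v : ℝ → ℂ}, Integrable v unitVol →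
      Integrable (fun x => φ x • v x) unitVol := fun hφ _ hv =>
    integrable_smul hφ.contDiff.continuous hφ.hasCompactSupport hv
  have hi' : ∀ {φ : ℝ → ℝ}, IsTestFunction φ → Integrable φ unitVol := fun hφ =>
    (hφ.contDiff.continuous.integrable_of_hasCompactSupport hφ.hasCompactSupport).integrableOn
  have hz := ae_zero_of_forall_test (u := fun x => u x - c) (hu.sub (integrable_const c)) ?_
  · filter_upwards [hz] with x hx
    exact sub_eq_zero.1 hx
  intro ψ hψ
  set m := ∫ x in Ioo (0 : ℝ) 1, ψ x with hm
  have hf : IsTestFunction (fun x => ψ x - m * η x) := by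
    refine ⟨hψ.contDiff.sub (contDiff_const.mul hη.contDiff), ?_, ?_⟩
    · exact hψ.hasCompactSupport.sub hη.hasCompactSupport.mul_left
    · refine (tsupport_sub _ _).trans (union_subset hψ.tsupport_subset ?_)
      exact tsupport_mul_subset_right.trans hη.tsupport_subset
  obtain ⟨F, hF, hFd⟩ := exists_primitive hf (by
    rw [integral_sub (hi' hψ) ((hi' hη).const_mul m), integral_const_mul, hη1, mul_one, sub_self])
  have h1 := h F hF
  rw [hFd] at h1
  simp only [sub_smul, mul_smul] at h1
  have hmη : Integrable (fun x => m • η x • u x) unitVol := (hi hη hu).smul m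
  rw [integral_sub (hi hψ hu) hmη, integral_smul, ← hc] at h1
  simp only [smul_sub]
  rw [integral_sub (hi hψ hu) (hi hψ (integrable_const c)), integral_smul_const, ← hm]
  exact h1

theorem integral_deriv_smul_id {φ : ℝ → ℝ} (hφ : IsTestFunction φ) :
    ∫ x in Ioo (0 : ℝ) 1, deriv φ x * x = -∫ x in Ioo (0 : ℝ) 1, φ x := by
  have hz : ∀ x, x ∉ Ioo (0 : ℝ) 1 → φ x = 0 := fun x hx =>
    image_eq_zero_of_notMem_tsupport fun hx' => hx (hφ.tsupport_subset hx')
  have hd : ∀ x, HasDerivAt φ (deriv φ x) x := fun x =>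
    (hφ.contDiff.differentiable (by simp) x).hasDerivAt
  have key := intervalIntegral.integral_deriv_mul_eq_sub (a := 0) (b := 1) (u := φ)
    (v := fun x => x) (u' := deriv φ) (v' := fun _ => 1) (fun x _ => hd x)
    (fun x _ => hasDerivAt_id x)
    (hφ.deriv.contDiff.continuous.intervalIntegrable _ _) (intervalIntegrable_const)
  rw [hz 0 (by simp), hz 1 (by simp)] at key
  simp only [mul_one, zero_mul, sub_zero] at key
  have hdx : Continuous fun x => deriv φ x * x := hφ.deriv.contDiff.continuous.mul continuous_id
  rw [intervalIntegral.integral_add (hdx.intervalIntegrable _ _)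
    (hφ.contDiff.continuous.intervalIntegrable _ _),
    intervalIntegral.integral_of_le zero_le_one, intervalIntegral.integral_of_le zero_le_one,
    integral_Ioc_eq_integral_Ioo, integral_Ioc_eq_integral_Ioo] at key
  linarith

theorem eq_zero_of_weakDeriv_two_eq_zero {u : L2} (hu : u ∈ H2H10) (h : weakDeriv 2 u = 0) :
    u = 0 := by
  have h1 := hasWeakDeriv_weakDeriv hu.1 (show 1 ≤ 2 by norm_num)
  have h2 := hasWeakDeriv_weakDeriv hu.1 (show 2 ≤ 2 by norm_num)
  rw [h] at h2
  set g := weakDeriv 1 u with hg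
  obtain ⟨c, hc⟩ := ae_const_of_forall_test (integrable_coe g) (by
    intro φ hφ
    have e1 := h1 (deriv φ) hφ.deriv
    have e2 := h2 φ hφ
    rw [integral_smul_zero, mul_zero, iteratedDeriv_succ', e1] at e2
    simpa using e2)
  have hx : Integrable (fun x : ℝ => c * (x : ℂ)) unitVol := by
    have : Continuous fun x : ℝ => c * (x : ℂ) := by fun_prop
    exact (this.integrableOn_Icc (a := 0) (b := 1)).mono_set Ioo_subset_Icc_self
  obtain ⟨d, hd⟩ := ae_const_of_forall_test ((integrable_coe u).sub hx) (by
    intro φ hφ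
    have hφd := hφ.deriv
    simp only [Pi.sub_apply, smul_sub]
    rw [integral_sub
      (integrable_smul hφd.contDiff.continuous hφd.hasCompactSupport (integrable_coe u))
      (integrable_smul hφd.contDiff.continuous hφd.hasCompactSupport hx)]
    have e1 := h1 φ hφ
    rw [iteratedDeriv_one] at e1
    have e3 : ∫ x in Ioo (0 : ℝ) 1, φ x • g x = (∫ x in Ioo (0 : ℝ) 1, φ x : ℝ) • c := by
      rw [← integral_smul_const]
      refine integral_congr_ae ?_
      filter_upwards [hc] with x hx
      rw [hx]
    have e4 : ∫ x in Ioo (0 : ℝ) 1, deriv φ x • (c * (x : ℂ)) =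
        (∫ x in Ioo (0 : ℝ) 1, deriv φ x * x : ℝ) • c := by
      rw [← integral_smul_const]
      refine integral_congr_ae (Eventually.of_forall fun x => ?_)
      simp only [Complex.real_smul, Complex.ofReal_mul]
      ring
    rw [e1, e3, e4, integral_deriv_smul_id hφ]
    simp)
  obtain ⟨f, hf, hfu, hf0, hf1⟩ := hu.2.2
  have hlin : Continuous fun x : ℝ => c * (x : ℂ) + d := by fun_prop
  have hfl : f =ᵐ[unitVol] fun x : ℝ => c * (x : ℂ) + d := by
    filter_upwards [hfu, hd] with x h1 h2
    rw [← h1, ← h2]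
    simp
  have hcl : Icc (0 : ℝ) 1 ⊆ closure (interior (Icc (0 : ℝ) 1)) := by
    rw [interior_Icc, closure_Ioo zero_ne_one]
  have heq : EqOn f (fun x : ℝ => c * (x : ℂ) + d) (Icc 0 1) := by
    refine Measure.eqOn_of_ae_eq (μ := volume) ?_ hf hlin.continuousOn hcl
    rwa [← restrict_Ioo_eq_restrict_Icc]
  have k0 : d = 0 := by
    have := heq (left_mem_Icc.2 zero_le_one)
    rw [hf0] at this
    simpa using this.symm
  have k1 : c = 0 := by
    have := heq (right_mem_Icc.2 zero_le_one)
    rw [hf1, k0] at this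
    simpa using this.symm
  rw [Lp.eq_zero_iff_ae_eq_zero]
  filter_upwards [hfu, hfl] with x h1 h2
  rw [h1, h2, k0, k1]
  simp

/-! ### The energy space and the beam operator -/

/-- The underlying vector space of the energy space `𝓗 = (H²(0, 1) ∩ H¹₀(0, 1)) × L²(0, 1)`; its
elements are the pairs (displacement, velocity), and its norm is the energy norm below. -/
def EnergySpace : Type := H2H10 × L2

namespace EnergySpace

instance : AddCommGroup EnergySpace := inferInstanceAs (AddCommGroup (H2H10 × L2))

instance : Module ℂ EnergySpace := inferInstanceAs (Module ℂ (H2H10 × L2))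

/-- The displacement component, as a linear map. -/
def disp : EnergySpace →ₗ[ℂ] H2H10 := LinearMap.fst ℂ H2H10 L2

/-- The velocity component, as a linear map. -/
def vel : EnergySpace →ₗ[ℂ] L2 := LinearMap.snd ℂ H2H10 L2

/-- The element with given displacement and velocity. -/
def mk (u : H2H10) (v : L2) : EnergySpace := (u, v)

theorem ext_iff' {U V : EnergySpace} : U = V ↔ U.disp = V.disp ∧ U.vel = V.vel := Prod.ext_iff

/-- The energy inner product `⟨U, V⟩ = ∫₀¹ u₁'' v₁'' + ∫₀¹ u₂ v₂`, one factor of each product being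
conjugated (the first one, which is the convention for `inner`). -/
@[reducible]
def core : InnerProductSpace.Core ℂ EnergySpace where
  inner U V := inner ℂ (weakDeriv 2 (U.disp : L2)) (weakDeriv 2 (V.disp : L2))
    + inner ℂ U.vel V.vel
  conj_inner_symm U V := by simp only [map_add, inner_conj_symm]
  re_inner_nonneg U := by
    rw [map_add]
    exact add_nonneg inner_self_nonneg inner_self_nonneg
  add_left U V W := by
    rw [map_add, map_add, Submodule.coe_add,
      weakDeriv_add (mem_sobolev_two U.disp.2) (mem_sobolev_two V.disp.2) le_rfl,
      inner_add_left, inner_add_left]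
    ring
  smul_left U V c := by
    rw [map_smul, map_smul, Submodule.coe_smul,
      weakDeriv_smul c (mem_sobolev_two U.disp.2) le_rfl, inner_smul_left, inner_smul_left]
    ring
  definite U h := by
    have hre := congrArg Complex.re h
    rw [Complex.add_re, inner_self_eq_norm_sq_to_K, inner_self_eq_norm_sq_to_K] at hre
    simp only [← Complex.ofReal_pow, Complex.coe_algebraMap, Complex.ofReal_re, Complex.zero_re] at hre
    have h1 : ‖weakDeriv 2 (U.disp : L2)‖ ^ 2 = 0 := by
      nlinarith [sq_nonneg ‖weakDeriv 2 (U.disp : L2)‖, sq_nonneg ‖U.vel‖]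
    have h2 : ‖U.vel‖ ^ 2 = 0 := by
      nlinarith [sq_nonneg ‖weakDeriv 2 (U.disp : L2)‖, sq_nonneg ‖U.vel‖]
    have h3 : (U.disp : L2) = 0 :=
      eq_zero_of_weakDeriv_two_eq_zero U.disp.2 (norm_eq_zero.1 (pow_eq_zero_iff two_ne_zero |>.1 h1))
    have h4 : U.vel = 0 := norm_eq_zero.1 (pow_eq_zero_iff two_ne_zero |>.1 h2)
    exact ext_iff'.2 ⟨Subtype.ext h3, h4⟩

instance : NormedAddCommGroup EnergySpace := core.toNormedAddCommGroup

instance : InnerProductSpace ℂ EnergySpace := InnerProductSpace.ofCore core.toCore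

theorem inner_def (U V : EnergySpace) :
    inner ℂ U V = inner ℂ (weakDeriv 2 (U.disp : L2)) (weakDeriv 2 (V.disp : L2))
      + inner ℂ U.vel V.vel := rfl

end EnergySpace

open EnergySpace

/-- The beam operator `𝒜 (w, v) = (v, -D_x⁴ w + a₁ D_x² v)` in the energy space, with the domain
`H⁴_*(0, 1) × (H²(0, 1) ∩ H¹₀(0, 1))`. -/
def beamOperator (a₁ : ℝ) : EnergySpace →ₗ.[ℂ] EnergySpace where
  domain :=
    { carrier := {U | (U.disp : L2) ∈ H4star ∧ U.vel ∈ H2H10}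
      zero_mem' := by
        simp only [mem_ofPred_eq, map_zero, Submodule.coe_zero]
        exact ⟨zero_mem _, zero_mem _⟩
      add_mem' := fun hU hV => by
        simp only [mem_ofPred_eq, map_add, Submodule.coe_add]
        exact ⟨add_mem hU.1 hV.1, add_mem hU.2 hV.2⟩
      smul_mem' := fun c U hU => by
        simp only [mem_ofPred_eq, map_smul, Submodule.coe_smul]
        exact ⟨Submodule.smul_mem _ c hU.1, Submodule.smul_mem _ c hU.2⟩ }
  toFun :=
    { toFun := fun U => EnergySpace.mk ⟨(U : EnergySpace).vel, U.2.2⟩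
        (-weakDeriv 4 ((U : EnergySpace).disp : L2)
          + (a₁ : ℂ) • weakDeriv 2 (U : EnergySpace).vel)
      map_add' := fun U V => by
        refine ext_iff'.2 ⟨Subtype.ext (map_add vel (U : EnergySpace) (V : EnergySpace)), ?_⟩
        change -weakDeriv 4 (((U : EnergySpace).disp : L2) + ((V : EnergySpace).disp : L2))
            + (a₁ : ℂ) • weakDeriv 2 ((U : EnergySpace).vel + (V : EnergySpace).vel) =
          (-weakDeriv 4 ((U : EnergySpace).disp : L2)
            + (a₁ : ℂ) • weakDeriv 2 (U : EnergySpace).vel) +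
          (-weakDeriv 4 ((V : EnergySpace).disp : L2)
            + (a₁ : ℂ) • weakDeriv 2 (V : EnergySpace).vel)
        rw [weakDeriv_add U.2.1.1 V.2.1.1 le_rfl,
          weakDeriv_add (mem_sobolev_two U.2.2) (mem_sobolev_two V.2.2) le_rfl, smul_add]
        abel
      map_smul' := fun c U => by
        refine ext_iff'.2 ⟨Subtype.ext (map_smul vel c (U : EnergySpace)), ?_⟩
        change -weakDeriv 4 (c • ((U : EnergySpace).disp : L2))
            + (a₁ : ℂ) • weakDeriv 2 (c • (U : EnergySpace).vel) =
          c • (-weakDeriv 4 ((U : EnergySpace).disp : L2)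
            + (a₁ : ℂ) • weakDeriv 2 (U : EnergySpace).vel)
        rw [weakDeriv_smul c U.2.1.1 le_rfl, weakDeriv_smul c (mem_sobolev_two U.2.2) le_rfl,
          smul_add, smul_neg, smul_comm c (a₁ : ℂ)] }

/-! ### Semigroups -/

/-- `T` is a `C₀`-semigroup of contractions on `X`. -/
structure IsContractionSemigroup {X : Type*} [NormedAddCommGroup X] [NormedSpace ℂ X]
    (T : ℝ≥0 → X →L[ℂ] X) : Prop where
  map_zero : T 0 = ContinuousLinearMap.id ℂ X
  map_add : ∀ s t : ℝ≥0, T (s + t) = (T s).comp (T t)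
  tendsto_zero : ∀ x : X, Tendsto (fun t => T t x) (𝓝 0) (𝓝 x)
  norm_le_one : ∀ t : ℝ≥0, ‖T t‖ ≤ 1

/-- `A` is the (infinitesimal) generator of `T`: a vector `x` is in the domain of `A` exactly when
`(T t x - x) / t` converges as `t ↓ 0`, and then `A x` is the limit. -/
def IsGenerator {X : Type*} [NormedAddCommGroup X] [NormedSpace ℂ X]
    (A : X →ₗ.[ℂ] X) (T : ℝ≥0 → X →L[ℂ] X) : Prop :=
  ∀ x y : X, (x, y) ∈ A.graph ↔
    Tendsto (fun t : ℝ≥0 => ((t : ℂ)⁻¹) • (T t x - x)) (𝓝[>] 0) (𝓝 y)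

end HingedBeam

end

namespace HingedBeam

section Semigroup

variable {X : Type*} [NormedAddCommGroup X] [InnerProductSpace ℂ X]

/-! ### Contraction semigroups generated by maximal dissipative operators -/

/-! Let `L` be `-D_x²` with Dirichlet conditions, on `H2H10`. It is symmetric and nonnegative, and
has a bounded inverse `K` on `L2`. The hinged conditions say that `H4star` is the domain of `L²`
(`mem_H4star_iff`), so the operator is `(w, v) ↦ (v, -L²w - a₁Lv)`. In the energy product the cross
terms have opposite real parts, leaving `-a₁⟨Lv, v⟩ ≤ 0`: the operator is dissipative. For `c > 0`,
eliminating `v` from the resolvent equation and putting `w = K²z` leaves `(1 + a₁cK + c²K²)z = f`,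
which is solvable by coercivity. Completeness holds because `(w, v) ↦ (w'', v)` is an isometry onto
`L² × L²`.

Generation is then the Lumer–Phillips theorem, proved by Yosida approximation. The bounded operators
`c(cR - 1)`, with `R` the resolvent at `c`, are dissipative, commute, and tend to `A` on its dense
domain as `c → ∞`; their exponentials are contractions and converge strongly. The generator of the
limit extends `A`, and equals it because `1 - A` is already onto. -/

theorem hasDerivAt_exp_smul_apply [CompleteSpace X] (B : X →L[ℂ] X) (x : X) (t : ℝ) :
    HasDerivAt (fun s : ℝ => NormedSpace.exp (s • B) x) (NormedSpace.exp (t • B) (B x)) t :=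
  ((ContinuousLinearMap.apply ℂ X x).restrictScalars ℝ).hasFDerivAt.comp_hasDerivAt t
    (hasDerivAt_exp_smul_const B t)

theorem exp_smul_apply_comm [CompleteSpace X] {B C : X →L[ℂ] X} (h : Commute B C) (s : ℝ) (x : X) :
    NormedSpace.exp (s • B) (C x) = C (NormedSpace.exp (s • B) x) :=
  congrArg (fun L : X →L[ℂ] X => L x) ((h.smul_left s).exp_left).eq

theorem exp_smul_add_apply [CompleteSpace X] (B : X →L[ℂ] X) (s t : ℝ) (x : X) :
    NormedSpace.exp ((s + t) • B) x = NormedSpace.exp (s • B) (NormedSpace.exp (t • B) x) := by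
  let _ := NormedAlgebra.restrictScalars ℚ ℂ (X →L[ℂ] X)
  rw [add_smul, NormedSpace.exp_add_of_commute (((Commute.refl B).smul_left s).smul_right t)]
  rfl

/-- The squared norm of an orbit `u` has derivative `2 Re ⟨B u, u⟩ ≤ 0`. -/
theorem norm_exp_smul_apply_le [CompleteSpace X] {B : X →L[ℂ] X}
    (hB : ∀ x, (inner ℂ (B x) x).re ≤ 0) {t : ℝ} (ht : 0 ≤ t) (x : X) :
    ‖NormedSpace.exp (t • B) x‖ ≤ ‖x‖ := by
  let _ := InnerProductSpace.complexToReal (G := X)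
  have hd : ∀ s : ℝ, HasDerivAt (fun s : ℝ => ‖NormedSpace.exp (s • B) x‖ ^ 2) _ s :=
    fun s => (hasDerivAt_exp_smul_apply B x s).norm_sq
  have ha : Antitone fun s : ℝ => ‖NormedSpace.exp (s • B) x‖ ^ 2 := by
    refine antitone_of_deriv_nonpos (fun s => (hd s).differentiableAt) fun s => ?_
    rw [(hd s).deriv, exp_smul_apply_comm (Commute.refl B), real_inner_eq_re_inner ℂ,
      ← inner_conj_symm, RCLike.conj_re]
    exact mul_nonpos_of_nonneg_of_nonpos zero_le_two (hB _)
  have := ha ht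
  simp only [zero_smul, NormedSpace.exp_zero, one_apply_eq_self] at this
  exact le_of_sq_le_sq this (norm_nonneg _)

/-- The path `s ↦ exp(sB) exp((t - s)C) x` joins the two vectors. By commutation its derivative is a
product of contractions applied to `B x - C x`. -/
theorem norm_exp_smul_sub_le [CompleteSpace X] {B C : X →L[ℂ] X} (hBC : Commute B C)
    (hB : ∀ x, (inner ℂ (B x) x).re ≤ 0) (hC : ∀ x, (inner ℂ (C x) x).re ≤ 0)
    {t : ℝ} (ht : 0 ≤ t) (x : X) :
    ‖NormedSpace.exp (t • B) x - NormedSpace.exp (t • C) x‖ ≤ ‖B x - C x‖ * t := by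
  have hd : ∀ s : ℝ, HasDerivAt
      (fun s : ℝ => NormedSpace.exp (s • B) (NormedSpace.exp ((t - s) • C) x))
      (NormedSpace.exp (s • B) (NormedSpace.exp ((t - s) • C) (B x - C x))) s := by
    intro s
    have h1 := hasDerivAt_exp_smul_const (𝕂 := ℝ) B s
    have h2 := (hasDerivAt_exp_smul_const (𝕂 := ℝ) C (t - s)).scomp s
      ((hasDerivAt_id s).const_sub t)
    have h3 := ((ContinuousLinearMap.apply ℂ X x).restrictScalars ℝ).hasFDerivAt.comp_hasDerivAt s
      (h1.mul h2)
    refine h3.congr_deriv ?_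
    have e := exp_smul_apply_comm hBC.symm (t - s) x
    change NormedSpace.exp (s • B) (B (NormedSpace.exp ((t - s) • C) x)) +
      NormedSpace.exp (s • B) (((-1 : ℝ) • (NormedSpace.exp ((t - s) • C) * C)) x) = _
    rw [neg_one_smul, ← e, neg_apply, map_neg, map_sub, map_sub]
    exact (sub_eq_add_neg _ _).symm
  have := norm_image_sub_le_of_norm_deriv_le_segment' (a := 0) (b := t)
    (fun s _ => (hd s).hasDerivWithinAt) (C := ‖B x - C x‖) (fun s hs =>
      (norm_exp_smul_apply_le hB hs.1 _).trans
        (norm_exp_smul_apply_le hC (sub_nonneg.2 hs.2.le) _)) t ⟨ht, le_rfl⟩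
  simpa using this

/-- A quantitative first order expansion of the exponential: `y` is an approximation of `B x`, and
`z` a vector close to `y`. -/
theorem norm_exp_smul_sub_sub_le [CompleteSpace X] {B : X →L[ℂ] X}
    (hB : ∀ x, (inner ℂ (B x) x).re ≤ 0) {t : ℝ} (ht : 0 ≤ t) (x y z : X) :
    ‖NormedSpace.exp (t • B) x - x - t • y‖ ≤ (‖B x - y‖ + (2 * ‖y - z‖ + ‖B z‖ * t)) * t := by
  have hz : ∀ s : ℝ, 0 ≤ s → ‖NormedSpace.exp (s • B) z - z‖ ≤ ‖B z‖ * s := by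
    intro s hs
    simpa using norm_exp_smul_sub_le (Commute.zero_right B) hB (C := 0) (by simp) hs z
  have hy : ∀ s ∈ Ico 0 t, ‖NormedSpace.exp (s • B) (B x) - y‖ ≤
      ‖B x - y‖ + (2 * ‖y - z‖ + ‖B z‖ * t) := by
    intro s hs
    -- Only `z` is compared with its own orbit, so the bound involves `‖B z‖` and never `‖B y‖`; in
    -- the limit `y = A x` may lie outside the domain.
    have e : NormedSpace.exp (s • B) (B x) - y = NormedSpace.exp (s • B) (B x - y) +
        (NormedSpace.exp (s • B) (y - z) + (NormedSpace.exp (s • B) z - z) + (z - y)) := by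
      simp only [map_sub]
      abel
    have h1 := norm_exp_smul_apply_le hB hs.1 (B x - y)
    have h2 := norm_exp_smul_apply_le hB hs.1 (y - z)
    have h3 := hz s hs.1
    have h4 : ‖B z‖ * s ≤ ‖B z‖ * t := by gcongr; exact hs.2.le
    have h5 := norm_sub_rev z y
    have := norm_add_le (NormedSpace.exp (s • B) (B x - y))
      (NormedSpace.exp (s • B) (y - z) + (NormedSpace.exp (s • B) z - z) + (z - y))
    have := norm_add₃_le (a := NormedSpace.exp (s • B) (y - z))
      (b := NormedSpace.exp (s • B) z - z) (c := z - y)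
    rw [e]
    linarith
  have hd : ∀ s : ℝ, HasDerivAt (fun s : ℝ => NormedSpace.exp (s • B) x - x - s • y)
      (NormedSpace.exp (s • B) (B x) - y) s := by
    intro s
    simpa [Pi.sub_def] using ((hasDerivAt_exp_smul_apply B x s).sub_const x).sub
      ((hasDerivAt_id s).smul_const y)
  have := norm_image_sub_le_of_norm_deriv_le_segment' (a := 0) (b := t)
    (fun s _ => (hd s).hasDerivWithinAt) hy t ⟨ht, le_rfl⟩
  simpa using this

/-- Limits of the semigroups generated by commuting bounded dissipative operators. -/
theorem exists_tendsto_exp_smul_apply [CompleteSpace X] {B : ℕ → X →L[ℂ] X}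
    (hcomm : ∀ m n, Commute (B m) (B n)) (hB : ∀ n x, (inner ℂ (B n x) x).re ≤ 0)
    {D : Submodule ℂ X} (hD : Dense (D : Set X)) {A : D → X}
    (hA : ∀ x : D, Tendsto (fun n => B n x) atTop (𝓝 (A x))) {t : ℝ} (ht : 0 ≤ t) (x : X) :
    ∃ y, Tendsto (fun n => NormedSpace.exp (t • B n) x) atTop (𝓝 y) := by
  refine cauchySeq_tendsto_of_complete (Metric.cauchySeq_iff.2 fun ε hε => ?_)
  obtain ⟨z, hxz, hz⟩ := Metric.dense_iff.1 hD x (ε / 3) (by positivity)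
  have hxz' : ‖x - z‖ < ε / 3 := by rwa [← dist_eq_norm, dist_comm]
  obtain ⟨N, hN⟩ := Metric.cauchySeq_iff.1 (hA ⟨z, hz⟩).cauchySeq
    -- The denominator uses `t + 1` to allow `t = 0`.
    (ε / (3 * (t + 1))) (by positivity)
  refine ⟨N, fun m hm n hn => ?_⟩
  have h1 := norm_exp_smul_apply_le (hB m) ht (x - z)
  have h2 := norm_exp_smul_apply_le (hB n) ht (x - z)
  have h3 := norm_exp_smul_sub_le (hcomm m n) (hB m) (hB n) ht z
  have h4 : ‖B m z - B n z‖ * t ≤ ε / 3 := by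
    have := (hN m hm n hn).le
    rw [dist_eq_norm] at this
    calc ‖B m z - B n z‖ * t ≤ ε / (3 * (t + 1)) * (t + 1) := by
          gcongr
          linarith
      _ = ε / 3 := by field_simp
  rw [dist_eq_norm]
  have e : NormedSpace.exp (t • B m) x - NormedSpace.exp (t • B n) x =
      NormedSpace.exp (t • B m) (x - z) + (NormedSpace.exp (t • B m) z -
        NormedSpace.exp (t • B n) z) + - NormedSpace.exp (t • B n) (x - z) := by
    simp only [map_sub]
    abel
  have h5 := norm_add₃_le (a := NormedSpace.exp (t • B m) (x - z))
    (b := NormedSpace.exp (t • B m) z - NormedSpace.exp (t • B n) z) (c := - NormedSpace.exp (t • B n) (x - z))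
  rw [norm_neg] at h5
  rw [e]
  linarith

/-- The estimates for `exp(tBₙ)` are uniform in `n` and pass to the limit, and density extends
strong continuity from `D` to `X`. Differentiability at `0` is only asserted on `D`, which may be
smaller than the domain of the generator. -/
theorem exists_semigroup_of_tendsto [CompleteSpace X] {B : ℕ → X →L[ℂ] X}
    (hcomm : ∀ m n, Commute (B m) (B n)) (hB : ∀ n x, (inner ℂ (B n x) x).re ≤ 0)
    {D : Submodule ℂ X} (hD : Dense (D : Set X)) {A : D → X}
    (hA : ∀ x : D, Tendsto (fun n => B n x) atTop (𝓝 (A x))) :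
    ∃ T : ℝ≥0 → X →L[ℂ] X, IsContractionSemigroup T ∧
      ∀ x : D, Tendsto (fun t : ℝ≥0 => ((t : ℂ)⁻¹) • (T t x - x)) (𝓝[>] 0) (𝓝 (A x)) := by
  choose S hS using fun (t : ℝ≥0) (x : X) =>
    exists_tendsto_exp_smul_apply hcomm hB hD hA t.2 x
  have hSle : ∀ t x, ‖S t x‖ ≤ 1 * ‖x‖ := fun t x => by
    rw [one_mul]
    exact le_of_tendsto (hS t x).norm
      (Eventually.of_forall fun n => norm_exp_smul_apply_le (hB n) t.2 x)
  let T : ℝ≥0 → X →L[ℂ] X := fun t => LinearMap.mkContinuous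
    { toFun := S t
      map_add' := fun x y => tendsto_nhds_unique (hS t (x + y)) (by
        simpa only [map_add] using (hS t x).add (hS t y))
      map_smul' := fun c x => tendsto_nhds_unique (hS t (c • x)) (by
        simpa only [map_smul, RingHom.id_apply] using (hS t x).const_smul c) } 1 (hSle t)
  have hT : ∀ (t : ℝ≥0) (x : X),
      Tendsto (fun n => NormedSpace.exp ((t : ℝ) • B n) x) atTop (𝓝 (T t x)) := hS
  have hTle : ∀ t x, ‖T t x‖ ≤ ‖x‖ := fun t x => (hSle t x).trans_eq (one_mul _)
  have hlip : ∀ (x : D) (t : ℝ≥0), ‖T t x - x‖ ≤ ‖A x‖ * t := by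
    intro x t
    refine le_of_tendsto_of_tendsto ((hT t x).sub_const _).norm ((hA x).norm.mul_const _)
      (Eventually.of_forall fun n => ?_)
    simpa using norm_exp_smul_sub_le (Commute.zero_right (B n)) (hB n) (C := 0) (by simp) t.2
      (x : X)
  have hexp : ∀ (x z : D) (t : ℝ≥0),
      ‖T t x - x - (t : ℝ) • A x‖ ≤ (2 * ‖A x - z‖ + ‖A z‖ * t) * t := by
    intro x z t
    have h0 : Tendsto (fun n => ‖B n x - A x‖) atTop (𝓝 0) :=
      tendsto_iff_norm_sub_tendsto_zero.1 (hA x)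
    have := (h0.add (((hA z).norm.mul_const (t : ℝ)).const_add (2 * ‖A x - z‖))).mul_const (t : ℝ)
    rw [zero_add] at this
    exact le_of_tendsto_of_tendsto (((hT t x).sub_const _).sub_const _).norm this
      (Eventually.of_forall fun n => norm_exp_smul_sub_sub_le (hB n) t.2 _ _ _)
  refine ⟨T, ⟨?_, ?_, ?_, ?_⟩, ?_⟩
  · ext x
    refine tendsto_nhds_unique (hT 0 x) ?_
    simp
  · intro s t
    ext x
    refine tendsto_nhds_unique (hT (s + t) x) ?_
    have h1 := hT s (T t x)
    -- The inner vector also varies with `n`; uniform contractivity absorbs the error.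
    have h2 : Tendsto (fun n => NormedSpace.exp ((s : ℝ) • B n)
        (NormedSpace.exp ((t : ℝ) • B n) x - T t x)) atTop (𝓝 0) :=
      squeeze_zero_norm (fun n => norm_exp_smul_apply_le (hB n) s.2 _)
        (tendsto_iff_norm_sub_tendsto_zero.1 (hT t x))
    have h3 := h1.add h2
    rw [add_zero] at h3
    refine h3.congr fun n => ?_
    rw [← map_add, add_sub_cancel, NNReal.coe_add, exp_smul_add_apply]
  · intro x
    refine Metric.tendsto_nhds.2 fun ε hε => ?_
    obtain ⟨z, hxz, hz⟩ := Metric.dense_iff.1 hD x (ε / 4) (by positivity)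
    have h0 : Tendsto (fun t : ℝ≥0 => ‖A ⟨z, hz⟩‖ * t) (𝓝 0) (𝓝 (‖A ⟨z, hz⟩‖ * (0 : ℝ≥0))) :=
      (NNReal.continuous_coe.tendsto 0).const_mul _
    rw [NNReal.coe_zero, mul_zero] at h0
    filter_upwards [h0.eventually_lt_const (half_pos hε)] with t ht
    have hxz' : ‖z - x‖ < ε / 4 := by rwa [← dist_eq_norm]
    have h1 := hTle t (z - x)
    have h2 := hlip ⟨z, hz⟩ t
    have e : T t x - x = - T t (z - x) + (T t z - z) + (z - x) := by
      simp only [map_sub]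
      abel
    have h5 := norm_add₃_le (a := -T t (z - x)) (b := T t z - z) (c := z - x)
    rw [norm_neg] at h5
    rw [dist_eq_norm, e]
    dsimp only at h2
    linarith
  · exact fun t => ContinuousLinearMap.opNorm_le_bound _ zero_le_one fun x => by
      simpa using hTle t x
  · intro x
    refine Metric.tendsto_nhds.2 fun ε hε => ?_
    -- `A x` need not lie in `D`, so it is approximated by some `z` in `D`, for which `A z` makes
    -- sense.
    obtain ⟨z, hxz, hz⟩ := Metric.dense_iff.1 hD (A x) (ε / 4) (by positivity)
    have h0 : Tendsto (fun t : ℝ≥0 => ‖A ⟨z, hz⟩‖ * t) (𝓝 0) (𝓝 (‖A ⟨z, hz⟩‖ * (0 : ℝ≥0))) :=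
      (NNReal.continuous_coe.tendsto 0).const_mul _
    rw [NNReal.coe_zero, mul_zero] at h0
    filter_upwards [nhdsWithin_le_nhds (h0.eventually_lt_const (half_pos hε)),
      self_mem_nhdsWithin] with t ht htpos
    have htpos' : (0 : ℝ) < t := htpos
    have hxz' : ‖A x - z‖ < ε / 4 := by rwa [← dist_eq_norm, dist_comm]
    have h2 := hexp x ⟨z, hz⟩ t
    have e : ((t : ℂ)⁻¹) • (T t x - x) - A x = ((t : ℂ)⁻¹) • (T t x - x - (t : ℝ) • A x) := by
      have ht0 : (t : ℂ) ≠ 0 := by exact_mod_cast htpos'.ne'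
      rw [smul_sub _ (T t x - x), ← Complex.coe_smul, inv_smul_smul₀ ht0]
    have hn : ‖(t : ℂ)‖ = t := by simp
    rw [dist_eq_norm, e, norm_smul, norm_inv, hn, inv_mul_lt_iff₀ htpos', mul_comm]
    refine h2.trans_lt (mul_lt_mul_of_pos_right ?_ htpos')
    dsimp only
    linarith

/-! ### Resolvents and Yosida approximations of dissipative operators. -/

theorem re_inner_self (x : X) : (inner ℂ x x).re = ‖x‖ ^ 2 := inner_self_eq_norm_sq (𝕜 := ℂ) x

/-- Pair `c x - A x` with `x`: the real part is at least `c‖x‖²`, and Cauchy–Schwarz bounds it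
above. -/
theorem mul_norm_le_norm_smul_sub {A : X →ₗ.[ℂ] X}
    (hA : ∀ x : A.domain, (inner ℂ (A x) (x : X)).re ≤ 0) {c : ℝ} (x : A.domain) :
    c * ‖(x : X)‖ ≤ ‖(c : ℂ) • (x : X) - A x‖ := by
  rcases eq_or_ne (x : X) 0 with h | h
  · simp [h]
  have h1 := (Complex.re_le_norm _).trans
    (norm_inner_le_norm (𝕜 := ℂ) ((c : ℂ) • (x : X) - A x) (x : X))
  rw [inner_sub_left, inner_smul_left, Complex.conj_ofReal, Complex.sub_re, Complex.re_ofReal_mul,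
    re_inner_self] at h1
  refine le_of_mul_le_mul_right ?_ (norm_pos_iff.2 h)
  nlinarith [hA x]

/-- `R` is a right inverse of `c - A`. -/
def IsResolvent (A : X →ₗ.[ℂ] X) (c : ℝ) (R : X →L[ℂ] X) : Prop :=
  ∀ y, ∃ x : A.domain, (x : X) = R y ∧ (c : ℂ) • (x : X) - A x = y

/-- Dissipativity makes `c - A` injective, so a right inverse is also a left inverse. -/
theorem IsResolvent.apply_smul_sub {A : X →ₗ.[ℂ] X}
    (hA : ∀ x : A.domain, (inner ℂ (A x) (x : X)).re ≤ 0) {c : ℝ} (hc : 0 < c) {R : X →L[ℂ] X}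
    (hR : IsResolvent A c R) (x : A.domain) : R ((c : ℂ) • (x : X) - A x) = x := by
  obtain ⟨z, hz, hzx⟩ := hR ((c : ℂ) • (x : X) - A x)
  have h := mul_norm_le_norm_smul_sub hA (c := c) (z - x)
  rw [LinearPMap.map_sub, Submodule.coe_sub, smul_sub, sub_sub_sub_comm, hzx, sub_self,
    norm_zero] at h
  rw [← hz]
  exact sub_eq_zero.1 (norm_le_zero_iff.1 (nonpos_of_mul_nonpos_right h hc))

theorem exists_isResolvent {A : X →ₗ.[ℂ] X}
    (hA : ∀ x : A.domain, (inner ℂ (A x) (x : X)).re ≤ 0) {c : ℝ} (hc : 0 < c)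
    (hsurj : ∀ y, ∃ x : A.domain, (c : ℂ) • (x : X) - A x = y) :
    ∃ R : X →L[ℂ] X, IsResolvent A c R := by
  let L : A.domain →ₗ[ℂ] X := (c : ℂ) • A.domain.subtype - A.toFun
  have hL : ∀ x, L x = (c : ℂ) • (x : X) - A x := fun x => rfl
  have hinj : Function.Injective L := by
    refine (injective_iff_map_eq_zero L).2 fun x hx => Subtype.ext ?_
    have h := mul_norm_le_norm_smul_sub hA (c := c) x
    rw [← hL, hx, norm_zero] at h
    exact norm_le_zero_iff.1 (nonpos_of_mul_nonpos_right h hc)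
  let e : A.domain ≃ₗ[ℂ] X := LinearEquiv.ofBijective L ⟨hinj, hsurj⟩
  have he : ∀ y, (c : ℂ) • (e.symm y : X) - A (e.symm y) = y := fun y => by
    rw [← hL]
    exact e.apply_symm_apply y
  refine ⟨LinearMap.mkContinuous (A.domain.subtype ∘ₗ e.symm.toLinearMap) c⁻¹ fun y => ?_,
    fun y => ⟨e.symm y, rfl, he y⟩⟩
  have h := mul_norm_le_norm_smul_sub hA (c := c) (e.symm y)
  rw [he] at h
  rwa [inv_mul_eq_div, le_div_iff₀ hc, mul_comm]

theorem IsResolvent.mul_norm_apply_le {A : X →ₗ.[ℂ] X}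
    (hA : ∀ x : A.domain, (inner ℂ (A x) (x : X)).re ≤ 0) {c : ℝ} {R : X →L[ℂ] X}
    (hR : IsResolvent A c R) (y : X) : c * ‖R y‖ ≤ ‖y‖ := by
  obtain ⟨x, hx, hxy⟩ := hR y
  rw [← hx, ← hxy]
  exact mul_norm_le_norm_smul_sub hA x

/-- Apply `R` to `(c - A) S y = y + (c - d) S y`. -/
theorem IsResolvent.resolvent_identity {A : X →ₗ.[ℂ] X}
    (hA : ∀ x : A.domain, (inner ℂ (A x) (x : X)).re ≤ 0) {c d : ℝ} (hc : 0 < c)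
    {R S : X →L[ℂ] X} (hR : IsResolvent A c R) (hS : IsResolvent A d S) (y : X) :
    R y + ((c : ℂ) - d) • R (S y) = S y := by
  obtain ⟨x, hx, hxy⟩ := hS y
  have h := hR.apply_smul_sub hA hc x
  have e : (c : ℂ) • (x : X) - A x = y + ((c : ℂ) - d) • (x : X) := by
    rw [← hxy, sub_smul]
    abel
  rw [e, map_add, map_smul, hx] at h
  exact h

/-- Compare the resolvent identity with the one where the roles are exchanged, and cancel `c - d`.
-/
theorem IsResolvent.commute {A : X →ₗ.[ℂ] X}
    (hA : ∀ x : A.domain, (inner ℂ (A x) (x : X)).re ≤ 0) {c d : ℝ} (hc : 0 < c) (hd : 0 < d)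
    {R S : X →L[ℂ] X} (hR : IsResolvent A c R) (hS : IsResolvent A d S) (hcd : c ≠ d) :
    Commute R S := by
  ext y
  have h1 := hR.resolvent_identity hA hc hS y
  have h2 := hS.resolvent_identity hA hd hR y
  have h3 : ((c : ℂ) - d) • R (S y) = ((c : ℂ) - d) • S (R y) := by
    have e1 : ((c : ℂ) - d) • R (S y) = S y - R y := eq_sub_of_add_eq' h1
    have e2 : ((d : ℂ) - c) • S (R y) = R y - S y := eq_sub_of_add_eq' h2
    rw [e1, ← neg_sub (d : ℂ) c, neg_smul, e2]
    abel
  exact smul_right_injective X (sub_ne_zero.2 (by exact_mod_cast hcd)) h3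

/-- If `y` is orthogonal to the domain and `x - A x = y`, then `0 = Re ⟨y, x⟩ ≥ ‖x‖²`, so `x = 0`
and `y = 0`. -/
theorem dense_domain [CompleteSpace X] {A : X →ₗ.[ℂ] X}
    (hA : ∀ x : A.domain, (inner ℂ (A x) (x : X)).re ≤ 0)
    (hsurj : ∀ y, ∃ x : A.domain, ((1 : ℝ) : ℂ) • (x : X) - A x = y) :
    Dense (A.domain : Set X) := by
  rw [Submodule.dense_iff_topologicalClosure_eq_top, Submodule.topologicalClosure_eq_top_iff,
    Submodule.eq_bot_iff]
  intro y hy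
  obtain ⟨x, hx⟩ := hsurj y
  have h := congrArg Complex.re ((Submodule.mem_orthogonal' _ _).1 hy x x.2)
  rw [← hx, Complex.ofReal_one, one_smul, inner_sub_left, Complex.sub_re, re_inner_self,
    Complex.zero_re] at h
  have h0 : ‖(x : X)‖ ^ 2 ≤ 0 := by linarith [hA x]
  have h1 : x = 0 := Subtype.ext (norm_eq_zero.1 (pow_eq_zero_iff two_ne_zero |>.1
    (le_antisymm h0 (sq_nonneg _))))
  rw [← hx, h1]
  simp

/-- The Yosida approximation of an operator with resolvent `R` at `c`. -/
def yosida (c : ℝ) (R : X →L[ℂ] X) : X →L[ℂ] X := (c : ℂ) • ((c : ℂ) • R - 1)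

theorem re_inner_yosida_nonpos {A : X →ₗ.[ℂ] X}
    (hA : ∀ x : A.domain, (inner ℂ (A x) (x : X)).re ≤ 0) {c : ℝ} (hc : 0 < c)
    {R : X →L[ℂ] X} (hR : IsResolvent A c R) (x : X) : (inner ℂ (yosida c R x) x).re ≤ 0 := by
  have e : yosida c R x = (c : ℂ) • ((c : ℂ) • R x - x) := rfl
  rw [e, inner_smul_left, Complex.conj_ofReal, Complex.re_ofReal_mul, inner_sub_left,
    inner_smul_left, Complex.conj_ofReal, Complex.sub_re, Complex.re_ofReal_mul, re_inner_self]
  refine mul_nonpos_of_nonneg_of_nonpos hc.le (sub_nonpos.2 ?_)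
  have h1 := (Complex.re_le_norm _).trans (norm_inner_le_norm (𝕜 := ℂ) (R x) x)
  have h2 := hR.mul_norm_apply_le hA x
  calc c * (inner ℂ (R x) x).re ≤ c * (‖R x‖ * ‖x‖) := by gcongr
    _ = c * ‖R x‖ * ‖x‖ := by ring
    _ ≤ ‖x‖ * ‖x‖ := by gcongr
    _ = ‖x‖ ^ 2 := by ring

theorem yosida_apply {A : X →ₗ.[ℂ] X}
    (hA : ∀ x : A.domain, (inner ℂ (A x) (x : X)).re ≤ 0) {c : ℝ} (hc : 0 < c)
    {R : X →L[ℂ] X} (hR : IsResolvent A c R) (x : A.domain) : yosida c R x = (c : ℂ) • R (A x) := by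
  have e : yosida c R x = (c : ℂ) • ((c : ℂ) • R x - x) := rfl
  have h := hR.apply_smul_sub hA hc x
  rw [map_sub, map_smul, sub_eq_iff_eq_add] at h
  rw [e, h, add_sub_cancel_left]

/-- On the domain the approximation is `cR(A x)`, so it suffices that `cR → 1` strongly. For `z` in
the domain `cR z - z = R(A z)` has norm at most `‖A z‖ / c`; density and `‖cR‖ ≤ 1` do the rest. -/
theorem tendsto_yosida [CompleteSpace X] {A : X →ₗ.[ℂ] X}
    (hA : ∀ x : A.domain, (inner ℂ (A x) (x : X)).re ≤ 0) (hD : Dense (A.domain : Set X))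
    {c : ℕ → ℝ} (hc : ∀ n, 0 < c n) (hlim : Tendsto c atTop atTop) {R : ℕ → X →L[ℂ] X}
    (hR : ∀ n, IsResolvent A (c n) (R n)) (x : A.domain) :
    Tendsto (fun n => yosida (c n) (R n) x) atTop (𝓝 (A x)) := by
  simp_rw [fun n => yosida_apply hA (hc n) (hR n)]
  have hle : ∀ n y, ‖(c n : ℂ) • R n y‖ ≤ ‖y‖ := fun n y => by
    rw [norm_smul, Complex.norm_real, Real.norm_of_nonneg (hc n).le]
    exact (hR n).mul_norm_apply_le hA y
  refine Metric.tendsto_nhds.2 fun ε hε => ?_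
  obtain ⟨z, hxz, hz⟩ := Metric.dense_iff.1 hD (A x) (ε / 4) (by positivity)
  have hxz' : ‖A x - z‖ < ε / 4 := by rwa [← dist_eq_norm, dist_comm]
  have h0 := (tendsto_inv_atTop_zero.comp hlim).mul_const ‖A ⟨z, hz⟩‖
  rw [zero_mul] at h0
  filter_upwards [h0.eventually_lt_const (half_pos hε)] with n hn
  have hn' : ‖(c n : ℂ) • R n z - z‖ ≤ (c n)⁻¹ * ‖A ⟨z, hz⟩‖ := by
    have h := (hR n).apply_smul_sub hA (hc n) ⟨z, hz⟩
    rw [map_sub, map_smul, sub_eq_iff_eq_add] at h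
    dsimp only at h
    rw [h, add_sub_cancel_left, le_inv_mul_iff₀ (hc n)]
    exact (hR n).mul_norm_apply_le hA _
  have h1 := hle n (A x - z)
  have e : (c n : ℂ) • R n (A x) - A x =
      (c n : ℂ) • R n (A x - z) + ((c n : ℂ) • R n z - z) + -(A x - z) := by
    rw [map_sub, smul_sub]
    abel
  have h5 := norm_add₃_le (a := (c n : ℂ) • R n (A x - z)) (b := (c n : ℂ) • R n z - z)
    (c := -(A x - z))
  rw [norm_neg] at h5
  rw [dist_eq_norm, e]
  simp only [Function.comp_apply] at hn
  linarith

/-- **Lumer–Phillips theorem** in a Hilbert space. -/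
theorem exists_isContractionSemigroup_isGenerator [CompleteSpace X] {A : X →ₗ.[ℂ] X}
    (hA : ∀ x : A.domain, (inner ℂ (A x) (x : X)).re ≤ 0)
    (hsurj : ∀ c : ℝ, 0 < c → ∀ y, ∃ x : A.domain, (c : ℂ) • (x : X) - A x = y) :
    ∃ T : ℝ≥0 → X →L[ℂ] X, IsContractionSemigroup T ∧ IsGenerator A T := by
  have hD := dense_domain hA (hsurj 1 one_pos)
  have hc : ∀ n : ℕ, (0 : ℝ) < n + 1 := fun n => by positivity
  choose R hR using fun n : ℕ => exists_isResolvent hA (hc n) (hsurj _ (hc n))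
  have hcommR : ∀ m n, Commute (R m) (R n) := by
    intro m n
    rcases eq_or_ne m n with rfl | hmn
    · exact Commute.refl _
    · exact (hR m).commute hA (hc m) (hc n) (hR n) (by simpa using hmn)
  have hcomm : ∀ m n : ℕ, Commute (yosida (m + 1) (R m)) (yosida (n + 1) (R n)) := fun m n =>
    (((((hcommR m n).smul_left _).smul_right _).sub_left (Commute.one_left _)).sub_right
      (Commute.one_right _)).smul_left _ |>.smul_right _
  obtain ⟨T, hT, hTA⟩ := exists_semigroup_of_tendsto hcomm
    (fun n => re_inner_yosida_nonpos hA (hc n) (hR n)) hD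
    (tendsto_yosida hA hD hc (tendsto_atTop_add_const_right _ _ tendsto_natCast_atTop_atTop) hR)
  refine ⟨T, hT, fun x y => ⟨fun h => ?_, fun h => ?_⟩⟩
  · obtain ⟨z, rfl, rfl⟩ := A.mem_graph_iff.1 h
    exact hTA z
  -- Maximality: `z` in the domain of `A` solves `z - A z = x - y`. The orbit of `x - z` then has
  -- initial derivative `y - A z = x - z`, while contractivity gives this derivative a nonpositive
  -- real product with `x - z`. Hence `x = z`.
  · obtain ⟨z, hz⟩ := hsurj 1 one_pos (x - y)
    have hlim := h.sub (hTA z)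
    have hxz : y - A z = x - z := by
      rw [Complex.ofReal_one, one_smul] at hz
      rw [sub_eq_sub_iff_add_eq_add] at hz ⊢
      rw [add_comm y, hz]
    simp_rw [← smul_sub] at hlim
    rw [hxz] at hlim
    have hre : (inner ℂ (x - z) (x - z)).re ≤ 0 := by
      refine le_of_tendsto (Complex.continuous_re.continuousAt.tendsto.comp
        (hlim.inner tendsto_const_nhds)) (Eventually.of_forall fun t => ?_)
      have e : T t x - x - (T t z - z) = T t (x - z) - (x - z) := by
        rw [map_sub]
        abel
      have hle : ‖T t (x - z)‖ ≤ ‖x - z‖ := by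
        simpa using (T t).le_of_opNorm_le (hT.norm_le_one t) (x - z)
      simp only [Function.comp_apply]
      rw [e, ← Complex.ofReal_inv, inner_smul_left, Complex.conj_ofReal, Complex.re_ofReal_mul,
        inner_sub_left, Complex.sub_re, re_inner_self]
      refine mul_nonpos_of_nonneg_of_nonpos (inv_nonneg.2 t.2) (sub_nonpos.2 ?_)
      calc (inner ℂ (T t (x - z)) (x - z)).re ≤ ‖T t (x - z)‖ * ‖x - z‖ :=
            (Complex.re_le_norm _).trans (norm_inner_le_norm _ _)
        _ ≤ ‖x - z‖ * ‖x - z‖ := by gcongr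
        _ = ‖x - z‖ ^ 2 := by ring
    rw [re_inner_self] at hre
    have h0 : x = z := sub_eq_zero.1 (norm_eq_zero.1 (pow_eq_zero_iff two_ne_zero |>.1
      (le_antisymm hre (sq_nonneg _))))
    rw [h0, sub_self, sub_eq_zero] at hxz
    rw [h0, hxz]
    exact A.mem_graph z

end Semigroup

/-! ### The second derivative with Dirichlet boundary conditions -/

theorem integrable_unitVol_of_continuous {f : ℝ → ℂ} (hf : Continuous f) : Integrable f unitVol :=
  (hf.integrableOn_Icc (a := 0) (b := 1)).mono_set Ioo_subset_Icc_self

theorem memLp_unitVol_of_continuous {f : ℝ → ℂ} (hf : Continuous f) : MemLp f 2 unitVol := by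
  obtain ⟨C, hC⟩ := isCompact_Icc.exists_bound_of_continuousOn (hf.continuousOn (s := Icc 0 1))
  refine MemLp.of_bound hf.aestronglyMeasurable C ?_
  filter_upwards [ae_restrict_mem measurableSet_Ioo] with x hx
  exact hC x (Ioo_subset_Icc_self hx)

/-- Integration by parts against the primitive of an integrable function. -/
theorem integral_mul_eq_neg_integral_deriv_mul_primitive {f v v' : ℝ → ℂ}
    (hf : Integrable f unitVol) (hv : ∀ x, HasDerivAt v (v' x) x) (hv' : Continuous v')
    (h1 : v 1 = 0) :
    ∫ x in Ioo (0 : ℝ) 1, v x * f x =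
      -∫ x in Ioo (0 : ℝ) 1, v' x * ∫ t in (0 : ℝ)..x, (Ioo (0 : ℝ) 1).indicator f t := by
  -- Fubini on the triangle `t < x` replaces differentiation of the primitive, since `f` is merely
  -- integrable. Since `v 1 = 0`, the integral of `v'` over `(t, 1)` is `-v t`.
  have hK : Integrable (Function.uncurry fun x t : ℝ => (Iio x).indicator (fun t => v' x * f t) t)
      (unitVol.prod unitVol) := by
    have h := ((integrable_unitVol_of_continuous hv').mul_prod hf).indicator
      (measurableSet_lt measurable_snd measurable_fst)
    refine h.congr (Eventually.of_forall fun p => ?_)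
    simp [Function.uncurry, indicator_apply]
  have hswap := integral_integral_swap hK
  have e1 : ∀ x ∈ Ioo (0 : ℝ) 1, ∫ t in Ioo (0 : ℝ) 1, (Iio x).indicator (fun t => v' x * f t) t =
      v' x * ∫ t in (0 : ℝ)..x, (Ioo (0 : ℝ) 1).indicator f t := by
    intro x hx
    rw [intervalIntegral.integral_of_le hx.1.le, integral_Ioc_eq_integral_Ioo,
      setIntegral_indicator measurableSet_Iio, setIntegral_indicator measurableSet_Ioo,
      integral_const_mul]
    congr 3
    ext t
    simp only [mem_inter_iff, mem_Ioo, mem_Iio]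
    constructor
    · rintro ⟨⟨h0, h1⟩, h2⟩
      exact ⟨⟨h0, h2⟩, h0, h1⟩
    · rintro ⟨⟨h0, h2⟩, -, h1⟩
      exact ⟨⟨h0, h1⟩, h2⟩
  have e2 : ∀ t ∈ Ioo (0 : ℝ) 1, ∫ x in Ioo (0 : ℝ) 1, (Iio x).indicator (fun t => v' x * f t) t =
      -(v t * f t) := by
    intro t ht
    have hi : ∀ x, (Iio x).indicator (fun t => v' x * f t) t =
        (Ioi t).indicator (fun x => v' x * f t) x := fun x => by simp [indicator_apply]
    have hs : Ioo (0 : ℝ) 1 ∩ Ioi t = Ioo t 1 := by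
      ext x
      simp only [mem_inter_iff, mem_Ioo, mem_Ioi]
      exact ⟨fun h => ⟨h.2, h.1.2⟩, fun h => ⟨⟨ht.1.trans h.1, h.2⟩, h.1⟩⟩
    simp_rw [hi]
    rw [setIntegral_indicator measurableSet_Ioi, hs, integral_mul_const,
      ← integral_Ioc_eq_integral_Ioo, ← intervalIntegral.integral_of_le ht.2.le,
      intervalIntegral.integral_eq_sub_of_hasDerivAt (fun x _ => hv x)
        (hv'.intervalIntegrable _ _), h1, zero_sub, neg_mul]
  rw [setIntegral_congr_fun measurableSet_Ioo e1, setIntegral_congr_fun measurableSet_Ioo e2,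
    integral_neg] at hswap
  rw [hswap, neg_neg]

/-- Classical integration by parts. -/
theorem integral_deriv_mul_eq_neg {u u' v v' : ℝ → ℂ} (hu : ∀ x, HasDerivAt u (u' x) x)
    (hu' : Continuous u') (hv : ∀ x, HasDerivAt v (v' x) x) (hv' : Continuous v')
    (h0 : u 0 = 0) (h1 : u 1 = 0) :
    ∫ x in Ioo (0 : ℝ) 1, u' x * v x = -∫ x in Ioo (0 : ℝ) 1, u x * v' x := by
  have h := intervalIntegral.integral_mul_deriv_eq_deriv_mul (a := 0) (b := 1)
    (fun x _ => hu x) (fun x _ => hv x) (hu'.intervalIntegrable _ _) (hv'.intervalIntegrable _ _)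
  rw [h0, h1, zero_mul, zero_mul, sub_zero, zero_sub,
    intervalIntegral.integral_of_le zero_le_one, intervalIntegral.integral_of_le zero_le_one,
    integral_Ioc_eq_integral_Ioo, integral_Ioc_eq_integral_Ioo] at h
  rw [h, neg_neg]

/-- Every square integrable function is, in the weak sense, the second derivative of a `C¹` function
that vanishes at both ends of the interval. -/
theorem exists_solution_dirichlet {g : ℝ → ℂ} (hg : Integrable g unitVol) :
    ∃ F F' : ℝ → ℂ, (∀ x, HasDerivAt F (F' x) x) ∧ Continuous F' ∧ F 0 = 0 ∧ F 1 = 0 ∧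
      ∀ v v' : ℝ → ℂ, (∀ x, HasDerivAt v (v' x) x) → Continuous v' → v 0 = 0 → v 1 = 0 →
        ∫ x in Ioo (0 : ℝ) 1, v x * g x = -∫ x in Ioo (0 : ℝ) 1, v' x * F' x := by
  set G : ℝ → ℂ := fun x => ∫ t in (0 : ℝ)..x, (Ioo (0 : ℝ) 1).indicator g t with hG
  have hGc : Continuous G := intervalIntegral.continuous_primitive
    (fun a b => ((integrable_indicator_iff measurableSet_Ioo).2 hg).intervalIntegrable) 0
  have hGd : ∀ x, HasDerivAt (fun x => ∫ t in (0 : ℝ)..x, G t) (G x) x := fun x =>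
    intervalIntegral.integral_hasDerivAt_right (hGc.intervalIntegrable _ _)
      (hGc.stronglyMeasurableAtFilter _ _) hGc.continuousAt
  -- Subtracting the mean of `G` enforces `F 1 = 0`; it does not affect the weak identity because
  -- `v'` has integral zero.
  set c : ℂ := ∫ t in (0 : ℝ)..1, G t with hc
  refine ⟨fun x => (∫ t in (0 : ℝ)..x, G t) - x * c, fun x => G x - c, fun x => ?_,
    hGc.sub continuous_const, by simp, by simp [hc], fun v v' hv hv' h0 h1 => ?_⟩
  · have := (hGd x).sub ((Complex.ofRealCLM.hasDerivAt (x := x)).mul_const c)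
    simpa [Pi.sub_def] using this
  · have e : ∫ x in Ioo (0 : ℝ) 1, v' x = 0 := by
      rw [← integral_Ioc_eq_integral_Ioo, ← intervalIntegral.integral_of_le zero_le_one,
        intervalIntegral.integral_eq_sub_of_hasDerivAt (fun x _ => hv x)
        (hv'.intervalIntegrable _ _), h0, h1, sub_zero]
    rw [integral_mul_eq_neg_integral_deriv_mul_primitive hg hv hv' h1]
    simp only [mul_sub]
    have hi1 : Integrable (fun x => v' x * G x) unitVol :=
      integrable_unitVol_of_continuous (hv'.mul hGc)
    have hi2 : Integrable (fun x => v' x * c) unitVol :=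
      integrable_unitVol_of_continuous (hv'.mul continuous_const)
    rw [integral_sub hi1 hi2, integral_mul_const, e, zero_mul, sub_zero]

theorem IsTestFunction.hasDerivAt_ofReal {φ : ℝ → ℝ} (h : IsTestFunction φ) (x : ℝ) :
    HasDerivAt (fun x => (φ x : ℂ)) ((_root_.deriv φ x : ℝ) : ℂ) x :=
  (h.contDiff.differentiable (by simp) x).hasDerivAt.ofReal_comp

theorem IsTestFunction.continuous_ofReal {φ : ℝ → ℝ} (h : IsTestFunction φ) :
    Continuous fun x => (φ x : ℂ) :=
  Complex.continuous_ofReal.comp h.contDiff.continuous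

theorem IsTestFunction.apply_zero {φ : ℝ → ℝ} (h : IsTestFunction φ) : φ 0 = 0 :=
  image_eq_zero_of_notMem_tsupport fun hx => lt_irrefl _ (h.tsupport_subset hx).1

theorem IsTestFunction.apply_one {φ : ℝ → ℝ} (h : IsTestFunction φ) : φ 1 = 0 :=
  image_eq_zero_of_notMem_tsupport fun hx => lt_irrefl _ (h.tsupport_subset hx).2

theorem integral_smul_congr {f : ℝ → ℝ} {u v : ℝ → ℂ} (h : u =ᵐ[unitVol] v) :
    ∫ x in Ioo (0 : ℝ) 1, f x • u x = ∫ x in Ioo (0 : ℝ) 1, (f x : ℂ) * v x :=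
  integral_congr_ae (by filter_upwards [h] with x hx; rw [hx, Complex.real_smul])

theorem hasWeakDeriv_zero (u : L2) : HasWeakDeriv 0 u u := fun φ _ => by simp

theorem IsTestFunction.iteratedDeriv {φ : ℝ → ℝ} (h : IsTestFunction φ) (k : ℕ) :
    IsTestFunction (iteratedDeriv k φ) := by
  induction k with
  | zero => simpa using h
  | succ k ih => rw [iteratedDeriv_succ]; exact ih.deriv

theorem iteratedDeriv_iteratedDeriv (j k : ℕ) (φ : ℝ → ℝ) :
    iteratedDeriv j (iteratedDeriv k φ) = iteratedDeriv (k + j) φ := by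
  simp only [iteratedDeriv_eq_iterate]
  rw [add_comm, Function.iterate_add_apply]

theorem HasWeakDeriv.comp {j k : ℕ} {u g h : L2} (hg : HasWeakDeriv j u g)
    (hh : HasWeakDeriv k g h) : HasWeakDeriv (k + j) u h := by
  intro φ hφ
  rw [← iteratedDeriv_iteratedDeriv, hg _ (hφ.iteratedDeriv k), hh φ hφ, pow_add]
  ring

/-- Testing the first relation with the `k`-th derivative of a test function and cancelling signs
shows that derivatives of `u` of higher order are derivatives of `g`. -/
theorem HasWeakDeriv.of_add {j k : ℕ} {u g h : L2} (hg : HasWeakDeriv j u g)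
    (hh : HasWeakDeriv (k + j) u h) : HasWeakDeriv k g h := by
  intro φ hφ
  have e := hh φ hφ
  rw [← iteratedDeriv_iteratedDeriv, hg _ (hφ.iteratedDeriv k), add_comm, pow_add, mul_assoc] at e
  exact mul_left_cancel₀ (pow_ne_zero j (by norm_num)) e

theorem exists_mem_H2H10_hasWeakDeriv_two (g : L2) :
    ∃ (u : L2) (F F' : ℝ → ℂ), u ∈ H2H10 ∧ weakDeriv 2 u = g ∧ u =ᵐ[unitVol] F ∧
      (∀ x, HasDerivAt F (F' x) x) ∧ Continuous F' ∧ F 0 = 0 ∧ F 1 = 0 ∧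
      ∀ v v' : ℝ → ℂ, (∀ x, HasDerivAt v (v' x) x) → Continuous v' → v 0 = 0 → v 1 = 0 →
        ∫ x in Ioo (0 : ℝ) 1, v x * g x = -∫ x in Ioo (0 : ℝ) 1, v' x * F' x := by
  obtain ⟨F, F', hF, hF', h0, h1, hibp⟩ := exists_solution_dirichlet (integrable_coe g)
  have hFc : Continuous F := continuous_iff_continuousAt.2 fun x => (hF x).continuousAt
  have hu := (memLp_unitVol_of_continuous hFc).coeFn_toLp
  have hu' := (memLp_unitVol_of_continuous hF').coeFn_toLp
  set u : L2 := (memLp_unitVol_of_continuous hFc).toLp F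
  set u' : L2 := (memLp_unitVol_of_continuous hF').toLp F'
  have hw1 : HasWeakDeriv 1 u u' := by
    intro φ hφ
    rw [iteratedDeriv_one, integral_smul_congr hu, integral_smul_congr hu', pow_one, neg_one_mul]
    exact integral_deriv_mul_eq_neg hφ.hasDerivAt_ofReal hφ.deriv.continuous_ofReal hF hF'
      (by simp [hφ.apply_zero]) (by simp [hφ.apply_one])
  have hw2 : HasWeakDeriv 1 u' g := by
    intro φ hφ
    rw [iteratedDeriv_one, integral_smul_congr hu', integral_smul_congr (ae_eq_refl g), pow_one,
      neg_one_mul, hibp _ _ hφ.hasDerivAt_ofReal hφ.deriv.continuous_ofReal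
      (by simp [hφ.apply_zero]) (by simp [hφ.apply_one]), neg_neg]
  have hw : HasWeakDeriv 2 u g := hw1.comp hw2
  have hS : u ∈ Sobolev 2 := by
    intro k hk
    interval_cases k
    exacts [⟨u, hasWeakDeriv_zero u⟩, ⟨u', hw1⟩, ⟨g, hw⟩]
  exact ⟨u, F, F', ⟨hS, fun k hk => hS k (hk.trans one_le_two), F, hFc.continuousOn, hu, h0, h1⟩,
    (hasWeakDeriv_weakDeriv hS le_rfl).unique hw, hu, hF, hF', h0, h1, hibp⟩

theorem weakDeriv_two_injective {u v : L2} (hu : u ∈ H2H10) (hv : v ∈ H2H10)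
    (h : weakDeriv 2 u = weakDeriv 2 v) : u = v := by
  refine sub_eq_zero.1 (eq_zero_of_weakDeriv_two_eq_zero (sub_mem hu hv) ?_)
  rw [sub_eq_add_neg, ← neg_one_smul ℂ, weakDeriv_add hu.1 (Submodule.smul_mem _ _ hv.1) le_rfl,
    weakDeriv_smul _ hv.1 le_rfl, h, neg_one_smul, add_neg_cancel]

/-- By injectivity of `D_x²` on `H2H10`, `u` is the explicit solution with datum `u''`. This
supplies a `C¹` representative and Green's formula without a Sobolev embedding. -/
theorem exists_representative {u : L2} (hu : u ∈ H2H10) :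
    ∃ (F F' : ℝ → ℂ), u =ᵐ[unitVol] F ∧
      (∀ x, HasDerivAt F (F' x) x) ∧ Continuous F' ∧ F 0 = 0 ∧ F 1 = 0 ∧
      ∀ v v' : ℝ → ℂ, (∀ x, HasDerivAt v (v' x) x) → Continuous v' → v 0 = 0 → v 1 = 0 →
        ∫ x in Ioo (0 : ℝ) 1, v x * weakDeriv 2 u x = -∫ x in Ioo (0 : ℝ) 1, v' x * F' x := by
  obtain ⟨w, F, F', hw, hwu, h⟩ := exists_mem_H2H10_hasWeakDeriv_two (weakDeriv 2 u)
  obtain rfl := weakDeriv_two_injective hw hu hwu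
  exact ⟨F, F', h⟩

theorem inner_eq_integral (u v : L2) :
    inner ℂ u v = ∫ x in Ioo (0 : ℝ) 1, star (u x) * v x := by
  rw [L2.inner_def]
  exact integral_congr_ae (Eventually.of_forall fun x => by
    simp [RCLike.inner_apply, mul_comm])

/-- The Dirichlet form. -/
theorem exists_inner_weakDeriv_two_eq :
    ∃ d : H2H10 → ℝ → ℂ, ∀ u v : H2H10, inner ℂ (u : L2) (weakDeriv 2 (v : L2)) =
      -∫ x in Ioo (0 : ℝ) 1, star (d u x) * d v x := by
  choose F F' hu hF hF' h0 h1 hibp using fun u : H2H10 => exists_representative u.2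
  refine ⟨F', fun u v => ?_⟩
  rw [inner_eq_integral, ← hibp v (fun x => star (F u x)) (fun x => star (F' u x))
    (fun x => (hF u x).star) (continuous_star.comp (hF' u)) (by simp [h0]) (by simp [h1])]
  refine integral_congr_ae ?_
  filter_upwards [hu u] with x hx
  rw [hx]

/-- Both sides equal the Dirichlet form, which is Hermitian. -/
theorem inner_weakDeriv_two_comm {u v : L2} (hu : u ∈ H2H10) (hv : v ∈ H2H10) :
    inner ℂ (weakDeriv 2 u) v = inner ℂ u (weakDeriv 2 v) := by
  obtain ⟨d, hd⟩ := exists_inner_weakDeriv_two_eq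
  rw [← inner_conj_symm, hd ⟨v, hv⟩ ⟨u, hu⟩, hd ⟨u, hu⟩ ⟨v, hv⟩, map_neg, ← integral_conj]
  congr 2
  ext x
  simp [mul_comm]

theorem re_inner_weakDeriv_two_nonpos {u : L2} (hu : u ∈ H2H10) :
    (inner ℂ u (weakDeriv 2 u)).re ≤ 0 := by
  obtain ⟨d, hd⟩ := exists_inner_weakDeriv_two_eq
  have e : ∀ z : ℂ, star z * z = ((‖z‖ ^ 2 : ℝ) : ℂ) := fun z => by
    rw [← starRingEnd_apply, Complex.conj_mul', Complex.ofReal_pow]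
  rw [hd ⟨u, hu⟩ ⟨u, hu⟩]
  simp_rw [e]
  rw [integral_complex_ofReal, Complex.neg_re, Complex.ofReal_re, neg_nonpos]
  exact integral_nonneg fun x => sq_nonneg _

/-! ### The hinged domain as the domain of a square. -/

theorem sobolev_mono {m n : ℕ} (h : m ≤ n) : Sobolev n ≤ Sobolev m := fun _ hu k hk =>
  hu k (hk.trans h)

theorem mem_H4star_iff {w : L2} : w ∈ H4star ↔ w ∈ H2H10 ∧ weakDeriv 2 w ∈ H2H10 := by
  constructor
  · rintro ⟨h4, h10, hv⟩
    have hS : weakDeriv 2 w ∈ Sobolev 2 := fun k hk =>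
      ⟨weakDeriv (k + 2) w, (hasWeakDeriv_weakDeriv h4 (by norm_num)).of_add
        (hasWeakDeriv_weakDeriv h4 (by omega))⟩
    exact ⟨⟨sobolev_mono (by norm_num) h4, h10⟩, hS, sobolev_mono one_le_two hS, hv⟩
  · rintro ⟨⟨hS, h10⟩, hS', h10'⟩
    refine ⟨fun k hk => ?_, h10, h10'.2⟩
    rcases le_or_gt k 2 with h | h
    · exact hS k h
    -- Orders 3 and 4 of `w` are orders `j = 1, 2` of `w''`.
    · obtain ⟨j, rfl⟩ := Nat.exists_eq_add_of_le' h.le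
      exact ⟨_, (hasWeakDeriv_weakDeriv hS le_rfl).comp (hasWeakDeriv_weakDeriv hS' (by omega))⟩

theorem weakDeriv_four {w : L2} (hw : w ∈ H4star) :
    weakDeriv 4 w = weakDeriv 2 (weakDeriv 2 w) := by
  obtain ⟨hw2, hw2'⟩ := mem_H4star_iff.1 hw
  exact (hasWeakDeriv_weakDeriv hw.1 le_rfl).unique
    ((hasWeakDeriv_weakDeriv hw2.1 le_rfl).comp (hasWeakDeriv_weakDeriv hw2'.1 le_rfl))

/-- The bounded inverse of `-D_x²` with Dirichlet boundary conditions. -/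
theorem exists_dirichlet_inverse :
    ∃ K : L2 →L[ℂ] L2, (∀ g, K g ∈ H2H10) ∧ ∀ g, weakDeriv 2 (K g) = -g := by
  have hex : ∀ g : L2, ∃ u ∈ H2H10, weakDeriv 2 u = -g := fun g => by
    obtain ⟨u, -, -, hu, hug, -⟩ := exists_mem_H2H10_hasWeakDeriv_two (-g)
    exact ⟨u, hu, hug⟩
  choose k hk hkg using hex
  let K : L2 →ₗ[ℂ] L2 :=
    { toFun := k
      map_add' := fun f g => weakDeriv_two_injective (hk _) (add_mem (hk f) (hk g)) (by
        rw [weakDeriv_add (hk f).1 (hk g).1 le_rfl, hkg, hkg, hkg, neg_add])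
      map_smul' := fun c g => weakDeriv_two_injective (hk _) (Submodule.smul_mem _ _ (hk g)) (by
        rw [RingHom.id_apply, weakDeriv_smul _ (hk g).1 le_rfl, hkg, hkg, smul_neg]) }
  have hsymm : K.IsSymmetric := fun f g => by
    have h := inner_weakDeriv_two_comm (hk f) (hk g)
    rw [hkg, hkg, inner_neg_left, inner_neg_right, neg_inj] at h
    exact h.symm
  -- Hellinger–Toeplitz: an everywhere defined symmetric operator is bounded.
  exact ⟨⟨K, hsymm.continuous⟩, hk, hkg⟩

/-- If `K` is symmetric and nonnegative then `1 + b K + c K²` is onto for `b, c ≥ 0`. -/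
theorem exists_add_smul_add_smul_eq {X : Type*} [NormedAddCommGroup X] [InnerProductSpace ℂ X]
    [CompleteSpace X] {K : X →L[ℂ] X} (hK : ∀ x y, inner ℂ (K x) y = inner ℂ x (K y))
    (hpos : ∀ x, 0 ≤ (inner ℂ (K x) x).re) {b c : ℝ} (hb : 0 ≤ b) (hc : 0 ≤ c) (y : X) :
    ∃ x, x + (b : ℂ) • K x + (c : ℂ) • K (K x) = y := by
  have hu : IsUnit (1 + (b : ℂ) • K + (c : ℂ) • K.comp K) := by
    -- Coercivity with constant `1`: the term in `b` is nonnegative and `⟨K²x, x⟩ = ‖K x‖²`.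
    refine ContinuousLinearMap.isUnit_of_forall_le_norm_inner_map (𝕜 := ℂ) _ one_pos fun x => ?_
    refine le_trans ?_ (Complex.re_le_norm _)
    change ‖x‖ ^ 2 * 1 ≤ (inner ℂ (x + (b : ℂ) • K x + (c : ℂ) • K (K x)) x).re
    rw [inner_add_left, inner_add_left, inner_smul_left, inner_smul_left, Complex.conj_ofReal,
      Complex.conj_ofReal, Complex.add_re, Complex.add_re, Complex.re_ofReal_mul,
      Complex.re_ofReal_mul, hK (K x) x, re_inner_self, re_inner_self]
    nlinarith [mul_nonneg hb (hpos x), mul_nonneg hc (sq_nonneg ‖K x‖)]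
  obtain ⟨x, hx⟩ := (ContinuousLinearMap.isUnit_iff_bijective.1 hu).2 y
  exact ⟨x, hx⟩

/-! ### Completeness of the energy space. -/

/-- The second weak derivative, as a linear map on `H²(0, 1) ∩ H¹₀(0, 1)`. -/
noncomputable def weakDerivTwo : H2H10 →ₗ[ℂ] L2 where
  toFun u := weakDeriv 2 (u : L2)
  map_add' u v := weakDeriv_add u.2.1 v.2.1 le_rfl
  map_smul' c u := weakDeriv_smul c u.2.1 le_rfl

namespace EnergySpace

theorem norm_sq_eq (U : EnergySpace) :
    ‖U‖ ^ 2 = ‖weakDeriv 2 (U.disp : L2)‖ ^ 2 + ‖U.vel‖ ^ 2 := by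
  rw [← re_inner_self, inner_def, Complex.add_re, re_inner_self, re_inner_self]

/-- The isometry `(w, v) ↦ (w'', v)` of the energy space into `L² × L²`. -/
noncomputable def toL2Prod : EnergySpace →ₗᵢ[ℂ] WithLp 2 (L2 × L2) where
  toLinearMap := (WithLp.linearEquiv 2 ℂ (L2 × L2)).symm.toLinearMap ∘ₗ
    (weakDerivTwo ∘ₗ disp).prod vel
  norm_map' U := by
    rw [← sq_eq_sq₀ (norm_nonneg _) (norm_nonneg _), WithLp.prod_norm_sq_eq_of_L2, norm_sq_eq]
    rfl

theorem toL2Prod_surjective : Function.Surjective toL2Prod := by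
  intro y
  obtain ⟨u, -, -, hu, hug, -⟩ := exists_mem_H2H10_hasWeakDeriv_two y.fst
  refine ⟨EnergySpace.mk ⟨u, hu⟩ y.snd, ?_⟩
  change WithLp.toLp 2 (weakDeriv 2 u, y.snd) = y
  rw [hug]
  rfl

instance : CompleteSpace EnergySpace :=
  (LinearIsometryEquiv.ofSurjective toL2Prod toL2Prod_surjective).toIsometryEquiv.completeSpace

end EnergySpace

/-! ### Dissipativity and range condition for the beam operator. -/

open EnergySpace

/-- Moving `D_x²` from `v` to `w''`, which also lies in `H2H10`, turns `⟨v'', w''⟩` into `⟨v,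
w''''⟩`. Its real part cancels that of `-⟨w'''', v⟩`, leaving only the damping term. -/
theorem re_inner_beamOperator_nonpos {a₁ : ℝ} (ha₁ : 0 ≤ a₁) (U : (beamOperator a₁).domain) :
    (inner ℂ (beamOperator a₁ U) (U : EnergySpace)).re ≤ 0 := by
  obtain ⟨hw, hv⟩ := U.2
  obtain ⟨hw2, hw2'⟩ := mem_H4star_iff.1 hw
  have e : inner ℂ (beamOperator a₁ U) (U : EnergySpace) =
      inner ℂ (weakDeriv 2 (vel (U : EnergySpace))) (weakDeriv 2 (disp (U : EnergySpace) : L2)) +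
      inner ℂ (-weakDeriv 4 (disp (U : EnergySpace) : L2)
        + (a₁ : ℂ) • weakDeriv 2 (vel (U : EnergySpace))) (vel (U : EnergySpace)) := rfl
  have h := re_inner_weakDeriv_two_nonpos hv
  rw [← inner_weakDeriv_two_comm hv hv] at h
  rw [e, weakDeriv_four hw, inner_weakDeriv_two_comm hv hw2', inner_add_left, inner_neg_left,
    inner_smul_left, Complex.conj_ofReal, Complex.add_re, Complex.add_re, Complex.re_ofReal_mul,
    ← inner_conj_symm, Complex.conj_re, Complex.neg_re, add_neg_cancel_left]
  exact mul_nonpos_of_nonneg_of_nonpos ha₁ h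

/-- Write `Y = (f, g)`. The first component forces `v = c w - f`, and the second becomes `w'''' -
a₁c w'' + c²w = g + c f - a₁f''`. With `w = K²z` one has `w'''' = z` and `w'' = -K z`, which gives
the equation solved by `exists_add_smul_add_smul_eq`. -/
theorem exists_smul_sub_beamOperator_eq {a₁ : ℝ} (ha₁ : 0 ≤ a₁) {c : ℝ} (hc : 0 < c)
    (Y : EnergySpace) :
    ∃ U : (beamOperator a₁).domain, (c : ℂ) • (U : EnergySpace) - beamOperator a₁ U = Y := by
  obtain ⟨K, hK, hKd⟩ := exists_dirichlet_inverse
  have hsymm : ∀ f g, inner ℂ (K f) g = inner ℂ f (K g) := fun f g => by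
    have h := inner_weakDeriv_two_comm (hK f) (hK g)
    rw [hKd, hKd, inner_neg_left, inner_neg_right, neg_inj] at h
    exact h.symm
  have hpos : ∀ f, 0 ≤ (inner ℂ (K f) f).re := fun f => by
    have h := re_inner_weakDeriv_two_nonpos (hK f)
    rwa [hKd, inner_neg_right, Complex.neg_re, neg_nonpos] at h
  obtain ⟨z, hz⟩ := exists_add_smul_add_smul_eq hsymm hpos (mul_nonneg ha₁ hc.le) (sq_nonneg c)
    (Y.vel + (c : ℂ) • (Y.disp : L2) - (a₁ : ℂ) • weakDeriv 2 (Y.disp : L2))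
  have hw : K (K z) ∈ H4star := mem_H4star_iff.2 ⟨hK _, by rw [hKd]; exact neg_mem (hK z)⟩
  have hw4 : weakDeriv 4 (K (K z)) = z := by
    rw [weakDeriv_four hw, hKd, ← map_neg, hKd, neg_neg]
  set w : H2H10 := ⟨K (K z), hK _⟩ with hwdef
  set v : H2H10 := (c : ℂ) • w - Y.disp with hvdef
  have hv2 : weakDeriv 2 (v : L2) = -(c : ℂ) • K z - weakDeriv 2 (Y.disp : L2) := by
    change weakDerivTwo v = _ - weakDerivTwo Y.disp
    rw [hvdef, map_sub, map_smul]
    change (c : ℂ) • weakDeriv 2 (K (K z)) - _ = _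
    rw [hKd, smul_neg, neg_smul]
  refine ⟨⟨EnergySpace.mk w v, hw, v.2⟩, ext_iff'.2 ⟨?_, ?_⟩⟩
  · change (c : ℂ) • w - v = Y.disp
    rw [hvdef, sub_sub_cancel]
  · change (c : ℂ) • (v : L2) - (-weakDeriv 4 (K (K z)) + (a₁ : ℂ) • weakDeriv 2 (v : L2)) = Y.vel
    have hvc : (v : L2) = (c : ℂ) • K (K z) - (Y.disp : L2) := rfl
    have hY : Y.vel = z + ((a₁ * c : ℝ) : ℂ) • K z + ((c ^ 2 : ℝ) : ℂ) • K (K z)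
        - (c : ℂ) • (Y.disp : L2) + (a₁ : ℂ) • weakDeriv 2 (Y.disp : L2) := by
      rw [hz]
      abel
    rw [hw4, hv2, hvc, hY]
    push_cast
    module

end HingedBeam

theorem theorem1 (a₁ : ℝ) (ha₁ : 0 ≤ a₁) :
    CompleteSpace HingedBeam.EnergySpace ∧
      ∃ T : ℝ≥0 → HingedBeam.EnergySpace →L[ℂ] HingedBeam.EnergySpace,
        HingedBeam.IsContractionSemigroup T ∧
          HingedBeam.IsGenerator (HingedBeam.beamOperator a₁) T :=
  ⟨inferInstance, HingedBeam.exists_isContractionSemigroup_isGenerator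
    (HingedBeam.re_inner_beamOperator_nonpos ha₁)
    fun _ hc Y => HingedBeam.exists_smul_sub_beamOperator_eq ha₁ hc Y⟩
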